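/- Let $G=(V,E)$ be an undirected unweighted graph with $V=\{1,\dots,n\}$ and distance function $d$ (where $d(u,v)=\infty$ if $u,v$ are not connected). For $v\in V$ let $T(v,r)=\{u : 0<d(u,v)\le r\}$, let $N(v,s)$ be the set of the first $\lfloor s\rfloor$ vertices other than $v$ met by a breadth-first search from $v$ (all of them if the search meets fewer; ties within a layer are broken in a fixed consistent order), let $\mathrm{ecc}(v)=\max_u d(v,u)$, let $\mathrm{ecc}(v,s)$ be the largest integer $k$ with $0\le k\le \mathrm{ecc}(v)$ and $T(v,k)\subseteq N(v,s)$ ($\infty$ if there is no largest one, which can happen only for disconnected $G$), and let $\mathrm{rad}(s)=\min_{v\in V}\mathrm{ecc}(v,s)$. An approximate distance oracle (ADO) for $G$ is a data structure, stored in the memory of a word RAM with words of $O(\log n)$ bits, from which a query program computes, for any given $u,v\in V$, an estimate $\hat d(u,v)$. It has constant query time if the program, which does not depend on $G$ or $n$, always halts after a number of steps bounded by a constant that does not depend on $G$ or $n$. It has $(a,b)$-stretch if $d(u,v)\le\hat d(u,v)\le\max\{d(u,v),\,a\,d(u,v)+b\}$ for all $u,v\in V$. **Lemma.** For every $n$-vertex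 graph $G$, every real $0\le\alpha<1/3$ and every real $c\ge1$ there is an ADO for $G$ with constant query time that uses $\tilde O(c\,n^{5/3+\alpha})$ space and has $(2,\,1-\mathrm{rad}(c\,n^{3\alpha}))$-stretch. More precisely, there are a single query program and constants $t,\kappa,K,C$, none of them depending on $G$, $n$, $\alpha$ or $c$, such that the word size is $\kappa(\lfloor\log_2 n\rfloor+1)$ (reading $\log_2 0$ as $0$), every query takes at most $t$ steps, and the data structure occupies at most $C\,c\,n^{5/3+\alpha}\,(\log(n+2))^{K}$ bits. -/

import Mathlib

namespace ADO

/-! ### Truncated breadth-first search -/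

section Graph

variable {n : ℕ} (G : SimpleGraph (Fin n))

/-- `T(v, r)`: the vertices `u` with `0 < d(u, v) ≤ r`. -/
def T (v : Fin n) (r : ℕ) : Set (Fin n) :=
  {u | 0 < G.edist u v ∧ G.edist u v ≤ (r : ℕ∞)}

/-- The number of vertices other than `v` that are met before `u` in the breadth-first search
from `v`. Vertices in the same layer are met in increasing order. -/
noncomputable def bfsRank (v u : Fin n) : ℕ :=
  {w : Fin n | w ≠ v ∧
    (G.edist w v < G.edist u v ∨ (G.edist w v = G.edist u v ∧ w < u))}.ncard

/-- `N(v, s)`: the first `⌊s⌋` vertices, excluding `v`, met during a breadth-first search from `v`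
(all the vertices reachable from `v`, excluding `v`, if there are fewer than `⌊s⌋` of them). -/
def N (v : Fin n) (s : ℝ) : Set (Fin n) :=
  {u | u ≠ v ∧ G.Reachable v u ∧ bfsRank G v u < ⌊s⌋₊}

/-- `ecc(v, s)`: the largest integer `0 ≤ k ≤ ecc(v)` with `T(v, k) ⊆ N(v, s)`. It is `⊤` if there
is no largest one, which can happen only if `ecc(v) = ⊤`, that is, if `G` is disconnected. -/
noncomputable def truncEcc (v : Fin n) (s : ℝ) : ℕ∞ :=
  sSup {k : ℕ∞ | ∃ j : ℕ, k = (j : ℕ∞) ∧ (j : ℕ∞) ≤ G.eccent v ∧ T G v j ⊆ N G v s}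

/-- `rad(s) = min_v ecc(v, s)`. -/
noncomputable def rad (s : ℝ) : ℕ∞ :=
  ⨅ v : Fin n, truncEcc G v s

end Graph

/-! ### Word RAM with read-only memory

A word is a `w`-bit vector and the arithmetic is modulo `2 ^ w`. A program is a finite list of
instructions. Registers and jump targets are named by numbers that are fixed in the program. -/

inductive Op
  | add
  | sub
  | mul
  | div
  | mod
  | lt

def Op.eval {w : ℕ} : Op → BitVec w → BitVec w → BitVec w
  | .add, x, y => x + y
  | .sub, x, y => x - y
  | .mul, x, y => x * y
  | .div, x, y => x / y
  | .mod, x, y => x % y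
  | .lt, x, y => if x.toNat < y.toNat then BitVec.ofNat w 1 else BitVec.ofNat w 0

inductive Instr
  /-- `const r k`: put the number `k` into register `r`. -/
  | const (r k : ℕ)
  /-- `op o r a b`: put the result of `o` on registers `a` and `b` into register `r`. -/
  | op (o : Op) (r a b : ℕ)
  /-- `load r a`: put the memory cell whose address is in register `a` into register `r`. -/
  | load (r a : ℕ)
  /-- `jumpZero a l`: go to instruction `l` if register `a` is zero. -/
  | jumpZero (a l : ℕ)

structure Config (w : ℕ) where
  pc : ℕ
  reg : ℕ → BitVec w

/-- One step; every instruction costs one step. The machine has halted when the program counter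
has left the program, and then the configuration does not change any more. Cells outside the memory
read as zero. -/
def step {w : ℕ} (P : List Instr) (mem : List (BitVec w)) (c : Config w) : Config w :=
  match P[c.pc]? with
  | none => c
  | some (.const r k) => ⟨c.pc + 1, Function.update c.reg r (BitVec.ofNat w k)⟩
  | some (.op o r a b) => ⟨c.pc + 1, Function.update c.reg r (o.eval (c.reg a) (c.reg b))⟩
  | some (.load r a) =>
      ⟨c.pc + 1, Function.update c.reg r (mem.getD (c.reg a).toNat (BitVec.ofNat w 0))⟩
  | some (.jumpZero a l) => if (c.reg a).toNat = 0 then ⟨l, c.reg⟩ else ⟨c.pc + 1, c.reg⟩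

/-- The configuration in which the inputs `x`, `y` stand in registers `0` and `1` and all the other
registers are zero. -/
def init {w : ℕ} (x y : BitVec w) : Config w where
  pc := 0
  reg i := if i = 0 then x else if i = 1 then y else BitVec.ofNat w 0

/-- On inputs `x`, `y`, the program `P` with memory `mem` halts after at most `t` steps with `out`
in register `0`. -/
def Answers {w : ℕ} (P : List Instr) (mem : List (BitVec w)) (t : ℕ) (x y out : BitVec w) : Prop :=
  P.length ≤ ((step P mem)^[t] (init x y)).pc ∧ ((step P mem)^[t] (init x y)).reg 0 = out

/-- Words of `O(log n)` bits. -/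
def wordSize (κ n : ℕ) : ℕ := κ * (Nat.log 2 n + 1)

/-- The distance that an output word stands for: the word with all bits `1` stands for `∞`. -/
def decode {w : ℕ} (x : BitVec w) : ℕ∞ :=
  if x.toNat = 2 ^ w - 1 then ⊤ else (x.toNat : ℕ∞)

/-! ### Approximate distance oracles -/

/-- Distances as extended reals. -/
noncomputable def toEReal (d : ℕ∞) : EReal := ((d : ENNReal) : EReal)

/-- `e` is an `(a, b)`-stretch estimate of `d`: `d ≤ e ≤ max {d, a * d + b}`. -/
def IsEstimate (a b : EReal) (d e : ℕ∞) : Prop :=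
  d ≤ e ∧ toEReal e ≤ max (toEReal d) (a * toEReal d + b)

/-- The data structure `mem` with the query program `P` is an approximate distance oracle for `G`
with query time at most `t` and `(a, b)`-stretch. -/
def IsOracle {n w : ℕ} (P : List Instr) (mem : List (BitVec w)) (t : ℕ)
    (G : SimpleGraph (Fin n)) (a b : EReal) : Prop :=
  ∀ u v : Fin n, ∃ out : BitVec w,
    Answers P mem t (BitVec.ofNat w u) (BitVec.ofNat w v) out ∧
      IsEstimate a b (G.edist u v) (decode out)

end ADO

/-! Write s = c n^(3α), r = rad(s), q = n^(2/3+α). Given a set A of centres, the cluster of w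
consists of the points u strictly closer to w than to all of A. The oracle stores the distances from
A to every vertex, and the distance of every linked pair (u, v): u in the cluster of w, v in the
cluster of w', d(w, w') finite and at most r. A query returns the minimum of the stored d(u, v), if
any, and the two detours through the pivots (nearest centres) of u and v.

Stretch: if a shortest path splits into lengths i + k + j with i < d(u, A), k ≤ r, j < d(v, A), its
two break points show that the pair is linked. So for an unlinked pair with neither end in A, d(u,
A) + d(v, A) + r ≤ d(u, v) + 1. The better detour costs at most d(u, v) + d(u, A) + d(v, A) ≤ 2 d(u,
v) + 1 - r (`isEstimate_storedEstimate`).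

Space: a ball of radius r has at most s + 1 vertices, so by AM-GM there are at most (s + 1) Σ
|cluster|² linked pairs. A greedy choice of ⌈q⌉ centres makes Σ |cluster|² at most 16 n³/q²
(`exists_card_le_sum_card_cluster_sq_le`), and q balances s n³/q² against the q n centre distances.

Constant time: the pairs are kept in a perfect two-level hash table (`exists_hashTable`), and the
query is an arithmetic expression compiled to jump-free code. -/

namespace ADO

/-! ### Compiling arithmetic expressions to jump-free programs -/

/-- Arithmetic expressions in two inputs, with memory access. -/
inductive QueryExpr
  | fst
  | snd
  | num (k : ℕ)
  | op (o : Op) (x y : QueryExpr)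
  | load (x : QueryExpr)

def QueryExpr.eval {w : ℕ} (mem : List (BitVec w)) (x y : BitVec w) : QueryExpr → BitVec w
  | .fst => x
  | .snd => y
  | .num k => BitVec.ofNat w k
  | .op o a b => o.eval (a.eval mem x y) (b.eval mem x y)
  | .load a => mem.getD (a.eval mem x y).toNat (BitVec.ofNat w 0)

/-- Code that puts the value of the expression into register `r` and does not touch the registers
below `r`, provided that the inputs stand in registers `0` and `1`. -/
def QueryExpr.compile : QueryExpr → ℕ → List Instr
  | .fst, r => [.const r 0, .op .add r r 0]
  | .snd, r => [.const r 0, .op .add r r 1]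
  | .num k, r => [.const r k]
  | .op o a b, r => a.compile r ++ b.compile (r + 1) ++ [.op o r r (r + 1)]
  | .load a, r => a.compile r ++ [.load r r]

/-- The effect of a single jump-free instruction on the registers. -/
def Instr.exec {w : ℕ} (mem : List (BitVec w)) (reg : ℕ → BitVec w) : Instr → ℕ → BitVec w
  | .const r k => Function.update reg r (BitVec.ofNat w k)
  | .op o r a b => Function.update reg r (o.eval (reg a) (reg b))
  | .load r a => Function.update reg r (mem.getD (reg a).toNat (BitVec.ofNat w 0))
  -- A default value: compiled code contains no jumps.
  | .jumpZero _ _ => reg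

def Instr.JumpFree (I : Instr) : Prop := ∀ a l, I ≠ .jumpZero a l

theorem step_of_jumpFree {w : ℕ} {P : List Instr} {mem : List (BitVec w)} {c : Config w}
    {I : Instr} (hI : P[c.pc]? = some I) (hj : I.JumpFree) :
    step P mem c = ⟨c.pc + 1, I.exec mem c.reg⟩ := by
  unfold step
  rw [hI]
  cases I with
  | jumpZero a l => exact absurd rfl (hj a l)
  | _ => rfl

theorem step_iterate_of_jumpFree {w : ℕ} {P : List Instr} (mem : List (BitVec w))
    (hP : ∀ I ∈ P, I.JumpFree) (reg : ℕ → BitVec w) {i : ℕ} (hi : i ≤ P.length) :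
    (step P mem)^[i] ⟨0, reg⟩ = ⟨i, (P.take i).foldl (Instr.exec mem) reg⟩ := by
  induction i with
  | zero => simp
  | succ i ih =>
    rw [Function.iterate_succ_apply', ih (by omega),
      step_of_jumpFree (List.getElem?_eq_getElem (by exact hi)) (hP _ (List.getElem_mem _)),
      List.take_succ_eq_append_getElem (by exact hi), List.foldl_append]
    rfl

theorem QueryExpr.jumpFree_compile (e : QueryExpr) (r : ℕ) :
    ∀ I ∈ e.compile r, I.JumpFree := by
  induction e generalizing r with
  | op o a b iha ihb =>
    intro I hI
    simp only [compile, List.mem_append, List.mem_singleton] at hI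
    rcases hI with (h | h) | rfl
    · exact iha _ _ h
    · exact ihb _ _ h
    · intro _ _; simp
  | load a iha =>
    intro I hI
    simp only [compile, List.mem_append, List.mem_singleton] at hI
    rcases hI with h | rfl
    · exact iha _ _ h
    · intro _ _; simp
  | _ =>
    intro I hI
    simp only [compile, List.mem_cons, List.not_mem_nil, or_false] at hI
    rcases hI with rfl | rfl <;> intro _ _ <;> simp

theorem QueryExpr.foldl_compile {w : ℕ} (mem : List (BitVec w)) (e : QueryExpr) (r : ℕ)
    (hr : 2 ≤ r) (reg : ℕ → BitVec w) :
    ((e.compile r).foldl (Instr.exec mem) reg) r = e.eval mem (reg 0) (reg 1) ∧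
      ∀ i < r, ((e.compile r).foldl (Instr.exec mem) reg) i = reg i := by
  induction e generalizing r reg with
  | op o a b iha ihb =>
    obtain ⟨ha, ha'⟩ := iha r hr reg
    obtain ⟨hb, hb'⟩ := ihb (r + 1) (by omega) ((a.compile r).foldl (Instr.exec mem) reg)
    simp only [compile, List.foldl_append, List.foldl_cons, List.foldl_nil, Instr.exec, eval]
    refine ⟨?_, fun i hi => ?_⟩
    · rw [Function.update_self, hb, hb' r (by omega), ha, ha' 0 (by omega), ha' 1 (by omega)]
    · rw [Function.update_of_ne (by omega), hb' i (by omega), ha' i hi]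
  | load a iha =>
    obtain ⟨ha, ha'⟩ := iha r hr reg
    simp only [compile, List.foldl_append, List.foldl_cons, List.foldl_nil, Instr.exec, eval]
    refine ⟨?_, fun i hi => ?_⟩
    · rw [Function.update_self, ha]
    · rw [Function.update_of_ne (by omega), ha' i hi]
  | num k =>
    refine ⟨by simp [compile, Instr.exec, eval], fun i hi => ?_⟩
    simp [compile, Instr.exec, Function.update_of_ne (show i ≠ r by omega)]
  | _ =>
    have h0 : (0 : ℕ) ≠ r := by omega
    have h1 : (1 : ℕ) ≠ r := by omega
    refine ⟨by simp [compile, Instr.exec, eval, Op.eval, h0, h1], fun i hi => ?_⟩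
    simp [compile, Instr.exec, Function.update_of_ne (show i ≠ r by omega)]

/-- A program that computes the expression. -/
def QueryExpr.program (e : QueryExpr) : List Instr :=
  e.compile 2 ++ [.const 0 0, .op .add 0 0 2]

/-- Without jumps each step advances the program counter by one, so the running time is the length
of the code, whatever the memory and the word size. -/
theorem QueryExpr.answers_program {w : ℕ} (e : QueryExpr) (mem : List (BitVec w))
    (x y : BitVec w) : Answers e.program mem e.program.length x y (e.eval mem x y) := by
  have hP : ∀ I ∈ e.program, I.JumpFree := by
    intro I hI
    simp only [program, List.mem_append, List.mem_cons, List.not_mem_nil, or_false] at hI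
    rcases hI with h | rfl | rfl
    · exact e.jumpFree_compile _ _ h
    all_goals intro _ _; simp
  obtain ⟨h, -⟩ := e.foldl_compile mem 2 le_rfl (init x y).reg
  unfold Answers
  rw [show init x y = ⟨0, (init x y).reg⟩ from rfl, step_iterate_of_jumpFree mem hP _ le_rfl,
    List.take_length]
  refine ⟨le_rfl, ?_⟩
  simp only [program, List.foldl_append, List.foldl_cons, List.foldl_nil, Instr.exec, Op.eval]
  rw [Function.update_self, Function.update_self, Function.update_of_ne (by omega), h]
  simp [init]

end ADO

namespace ADO

/-! ### Static dictionaries by two-level hashing -/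

/-- The multiplicative hash function with multiplier `a`, modulus `p` and range `r`. -/
def hash (p r a x : ℕ) : ℕ := a * x % p % r

/-- The map a ↦ a(x - y) mod p permutes the nonzero residues. A collision forces r to divide the
image or p minus the image, and each case allows at most (p - 1)/r values. -/
theorem card_hash_collision_le {p : ℕ} (hp : p.Prime) (r : ℕ) {x y : ℕ} (hx : x < p)
    (hy : y < p) (hxy : x ≠ y) :
    {a ∈ Finset.Ioc 0 (p - 1) | hash p r a x = hash p r a y}.card ≤ 2 * ((p - 1) / r) := by
  have : Fact p.Prime := ⟨hp⟩
  have hp2 := hp.two_le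
  set g : ℕ → ℕ := fun a => ((a : ZMod p) * ((x : ZMod p) - y)).val
  have hd : (x : ZMod p) - y ≠ 0 := by
    rw [sub_ne_zero, Ne, ZMod.natCast_eq_natCast_iff]
    exact fun h => hxy (Nat.ModEq.eq_of_lt_of_lt h hx hy)
  have hinj : Set.InjOn g (Finset.Ioc 0 (p - 1)) := by
    intro a ha b hb hab
    simp only [Finset.coe_Ioc, Set.mem_Ioc] at ha hb
    have h := mul_right_cancel₀ hd (ZMod.val_injective p hab)
    rw [ZMod.natCast_eq_natCast_iff] at h
    exact Nat.ModEq.eq_of_lt_of_lt h (by omega) (by omega)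
  have hmem : ∀ a ∈ Finset.Ioc 0 (p - 1), g a ∈ Finset.Ioc 0 (p - 1) := by
    intro a ha
    simp only [Finset.mem_Ioc] at ha ⊢
    have ha0 : (a : ZMod p) ≠ 0 := by
      rw [Ne, ZMod.natCast_eq_zero_iff]
      exact fun h => absurd (Nat.le_of_dvd ha.1 h) (by omega)
    have h1 : g a ≠ 0 := by
      simp only [g, ne_eq, ZMod.val_eq_zero]
      exact mul_ne_zero ha0 hd
    have h2 : g a < p := ZMod.val_lt _
    omega
  have hcase : ∀ a, hash p r a x = hash p r a y → r ∣ g a ∨ (r ∣ p - g a) := by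
    intro a h
    have hX : a * x % p < p := Nat.mod_lt _ hp.pos
    have hY : a * y % p < p := Nat.mod_lt _ hp.pos
    have h2 : g a < p := ZMod.val_lt _
    have hdvd : (r : ℤ) ∣ ((a * x % p : ℕ) : ℤ) - ((a * y % p : ℕ) : ℤ) :=
      (Nat.modEq_iff_dvd.mp (show a * y % p ≡ a * x % p [MOD r] from h.symm))
    have hg : (p : ℤ) ∣ ((a * x % p : ℕ) : ℤ) - ((a * y % p : ℕ) : ℤ) - g a := by
      rw [← ZMod.intCast_zmod_eq_zero_iff_dvd]
      push_cast
      simp only [g, ZMod.natCast_val, ZMod.cast_id', id_eq]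
      ring
    obtain ⟨k, hk⟩ := hg
    -- Both residues and `g a` lie in [0, p), so the difference p k lies strictly between -2p and p.
    have hk1 : k < 1 := by
      by_contra hcon
      have : (p : ℤ) * 1 ≤ p * k := by gcongr; omega
      omega
    have hk2 : -2 < k := by
      by_contra hcon
      have : (p : ℤ) * k ≤ p * (-2) := by gcongr; omega
      omega
    have : k = 0 ∨ k = -1 := by omega
    rcases this with rfl | rfl
    · left
      rw [← Int.natCast_dvd_natCast]
      convert hdvd using 1
      omega
    · right
      have h3 : (p : ℤ) - g a = -(((a * x % p : ℕ) : ℤ) - ((a * y % p : ℕ) : ℤ)) := by linarith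
      rwa [← Int.natCast_dvd_natCast, Nat.cast_sub h2.le, h3, dvd_neg]
  calc _ = (Finset.image g {a ∈ Finset.Ioc 0 (p - 1) | hash p r a x = hash p r a y}).card := by
        rw [Finset.card_image_of_injOn (hinj.mono (Finset.coe_subset.mpr (Finset.filter_subset _ _)))]
    _ ≤ ({t ∈ Finset.Ioc 0 (p - 1) | r ∣ t} ∪
          Finset.image (fun t => p - t) {t ∈ Finset.Ioc 0 (p - 1) | r ∣ t}).card := by
        apply Finset.card_le_card
        intro t ht
        obtain ⟨a, ha, rfl⟩ := Finset.mem_image.mp ht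
        obtain ⟨ha, hc⟩ := Finset.mem_filter.mp ha
        have hm := hmem a ha
        rw [Finset.mem_union, Finset.mem_filter, Finset.mem_image]
        rcases hcase a hc with h | h
        · exact Or.inl ⟨hm, h⟩
        · rw [Finset.mem_Ioc] at hm
          refine Or.inr ⟨p - g a, Finset.mem_filter.mpr ⟨Finset.mem_Ioc.mpr ?_, h⟩, ?_⟩ <;> omega
    _ ≤ (p - 1) / r + (p - 1) / r := by
        refine (Finset.card_union_le _ _).trans (add_le_add ?_ (Finset.card_image_le.trans ?_)) <;>
        rw [Nat.Ioc_filter_dvd_card_eq_div]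
    _ = _ := by ring

/-- Averaging of `card_hash_collision_le` over all nonzero multipliers. -/
theorem exists_hash_collision_le {p : ℕ} (hp : p.Prime) (r : ℕ) {S : Finset ℕ}
    (hS : ∀ x ∈ S, x < p) :
    ∃ a < p, {z ∈ S.offDiag | hash p r a z.1 = hash p r a z.2}.card * r ≤ 2 * S.card ^ 2 := by
  have hne : (Finset.Ioc 0 (p - 1)).Nonempty := by
    rw [Finset.nonempty_Ioc]; have := hp.two_le; omega
  obtain ⟨a, ha, h⟩ := Finset.exists_le_of_sum_le hne
    (f := fun a => {z ∈ S.offDiag | hash p r a z.1 = hash p r a z.2}.card * r)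
    (g := fun _ => 2 * S.card ^ 2) (by
      rw [← Finset.sum_mul]
      simp_rw [Finset.card_filter]
      rw [Finset.sum_comm]
      simp_rw [← Finset.card_filter]
      calc _ ≤ (∑ z ∈ S.offDiag, 2 * ((p - 1) / r)) * r := by
            gcongr with z hz
            rw [Finset.mem_offDiag] at hz
            exact card_hash_collision_le hp r (hS _ hz.1) (hS _ hz.2.1) hz.2.2
        _ = S.offDiag.card * 2 * ((p - 1) / r * r) := by
            rw [Finset.sum_const, smul_eq_mul]; ring
        _ ≤ S.card ^ 2 * 2 * (p - 1) := by
            gcongr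
            · rw [Finset.offDiag_card, sq]; exact Nat.sub_le _ _
            · exact Nat.div_mul_le_self _ _
        _ = _ := by rw [Finset.sum_const, Nat.card_Ioc, smul_eq_mul]; simp; ring)
  rw [Finset.mem_Ioc] at ha
  exact ⟨a, by have := hp.two_le; omega, h⟩

/-- Second level: a range exceeding 2|S|² pushes the collision count below 1. -/
theorem exists_injOn_hash {p : ℕ} (hp : p.Prime) {S : Finset ℕ} (hS : ∀ x ∈ S, x < p) :
    ∃ a < p, Set.InjOn (hash p (2 * S.card ^ 2 + 1) a) S := by
  obtain ⟨a, ha, h⟩ := exists_hash_collision_le hp (2 * S.card ^ 2 + 1) hS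
  refine ⟨a, ha, fun x hx y hy hxy => ?_⟩
  by_contra hne
  have : 0 < {z ∈ S.offDiag | hash p (2 * S.card ^ 2 + 1) a z.1 =
      hash p (2 * S.card ^ 2 + 1) a z.2}.card :=
    Finset.card_pos.mpr ⟨(x, y), by
      rw [Finset.mem_filter, Finset.mem_offDiag]; exact ⟨⟨hx, hy, hne⟩, hxy⟩⟩
  nlinarith

/-- First level: the sum of squared bucket sizes counts the |S| diagonal pairs and the colliding
pairs, of which a linear range leaves at most |S|. -/
theorem exists_sum_card_sq_hash_le {p : ℕ} (hp : p.Prime) {S : Finset ℕ} (hS : ∀ x ∈ S, x < p) :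
    ∃ a < p, ∑ i ∈ Finset.range (2 * S.card + 1),
      {x ∈ S | hash p (2 * S.card + 1) a x = i}.card ^ 2 ≤ 2 * S.card := by
  obtain ⟨a, ha, h⟩ := exists_hash_collision_le hp (2 * S.card + 1) hS
  refine ⟨a, ha, ?_⟩
  set f := hash p (2 * S.card + 1) a
  have hc : {z ∈ S.offDiag | f z.1 = f z.2}.card ≤ S.card := by
    by_contra hcon
    have : (S.card + 1) * (2 * S.card + 1) ≤ 2 * S.card ^ 2 :=
      (Nat.mul_le_mul_right _ (by omega)).trans h
    nlinarith
  have hf : ∀ z ∈ {z ∈ S ×ˢ S | f z.1 = f z.2}, f z.1 ∈ Finset.range (2 * S.card + 1) :=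
    fun z _ => Finset.mem_range.mpr (Nat.mod_lt _ (by omega))
  calc _ = {z ∈ S ×ˢ S | f z.1 = f z.2}.card := by
        rw [Finset.card_eq_sum_card_fiberwise hf]
        refine Finset.sum_congr rfl fun i _ => ?_
        rw [sq, ← Finset.card_product]
        congr 1
        ext z
        simp only [Finset.mem_product, Finset.mem_filter]
        constructor
        · rintro ⟨⟨h1, h2⟩, h3, h4⟩; exact ⟨⟨⟨h1, h3⟩, by rw [h2, h4]⟩, h2⟩
        · rintro ⟨⟨⟨h1, h3⟩, h5⟩, h2⟩; exact ⟨⟨h1, h2⟩, h3, by rw [← h5, h2]⟩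
    _ ≤ ({z ∈ S.offDiag | f z.1 = f z.2} ∪ S.diag).card := by
        apply Finset.card_le_card
        intro z hz
        simp only [Finset.mem_product, Finset.mem_filter, Finset.mem_union, Finset.mem_offDiag,
          Finset.mem_diag] at hz ⊢
        tauto
    _ ≤ 2 * S.card := by
        refine (Finset.card_union_le _ _).trans ?_
        rw [Finset.diag_card]; omega

/-- The parameters of a two-level hash table. -/
structure HashTable where
  /-- the prime modulus -/
  p : ℕ
  /-- the multiplier of the first level -/
  a : ℕ
  /-- the number of buckets -/
  r : ℕ
  /-- the first slot of a bucket -/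
  off : ℕ → ℕ
  /-- the multiplier of a bucket -/
  mult : ℕ → ℕ
  /-- the number of slots of a bucket -/
  size : ℕ → ℕ

/-- The slot of the key `x`. -/
def HashTable.slot (H : HashTable) (x : ℕ) : ℕ :=
  H.off (hash H.p H.r H.a x) +
    hash H.p (H.size (hash H.p H.r H.a x)) (H.mult (hash H.p H.r H.a x)) x

/-- All the parameters are bounded by `B`, and the table has at most `B` slots. -/
structure HashTable.Bounded (H : HashTable) (B : ℕ) : Prop where
  r_pos : 0 < H.r
  a_lt : H.a < H.p
  mult_lt : ∀ i, H.mult i < H.p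
  r_le : H.r ≤ B
  off_le : ∀ i < H.r, H.off i ≤ B
  size_pos : ∀ i, 0 < H.size i
  size_le : ∀ i < H.r, H.size i ≤ B
  slot_lt : ∀ x, H.slot x < B

theorem exists_hashTable {p : ℕ} (hp : p.Prime) {S : Finset ℕ} (hS : ∀ x ∈ S, x < p) :
    ∃ H : HashTable, H.p = p ∧ H.Bounded (6 * S.card + 1) ∧ Set.InjOn H.slot S := by
  obtain ⟨a, ha, hsum⟩ := exists_sum_card_sq_hash_le hp hS
  set r := 2 * S.card + 1 with hr
  have hb : ∀ i, ∃ m < p, Set.InjOn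
      (hash p (2 * {x ∈ S | hash p r a x = i}.card ^ 2 + 1) m) {x ∈ S | hash p r a x = i} :=
    fun i => by
      simpa using exists_injOn_hash hp (S := {x ∈ S | hash p r a x = i})
        fun x hx => hS x (Finset.mem_of_mem_filter x hx)
  choose m hm hinj using hb
  set size : ℕ → ℕ := fun i => 2 * {x ∈ S | hash p r a x = i}.card ^ 2 + 1 with hsize
  set off : ℕ → ℕ := fun i => ∑ j ∈ Finset.range i, size j with hoff
  set H : HashTable := ⟨p, a, r, off, m, size⟩ with hH
  have hmono : Monotone off := fun i j hij =>
    Finset.sum_le_sum_of_subset (Finset.range_subset_range.mpr hij)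
  have hsucc : ∀ i, off (i + 1) = off i + size i := fun i => Finset.sum_range_succ _ _
  -- A bucket with b keys gets 2b² + 1 slots; the total is at most 2(2|S|) + (2|S| + 1).
  have htot : off r ≤ 6 * S.card + 1 := by
    simp only [hoff, hsize]
    rw [Finset.sum_add_distrib, ← Finset.mul_sum]
    simp only [Finset.sum_const, Finset.card_range, smul_eq_mul, mul_one]
    omega
  have hlt : ∀ x, hash p r a x < r := fun x => Nat.mod_lt _ (by omega)
  have hslot : ∀ x, H.slot x < off (hash p r a x + 1) := by
    intro x
    rw [hsucc]
    exact Nat.add_lt_add_left (Nat.mod_lt _ (by simp only [hH, hsize]; omega)) _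
  refine ⟨H, rfl, ⟨by simp [hH, hr], ha, hm, by simp only [hH, hr]; omega,
    fun i hi => (hmono hi.le).trans htot, fun i => by simp [hH, hsize], fun i hi => ?_,
    fun x => (hslot x).trans_le ((hmono (hlt x)).trans htot)⟩, ?_⟩
  · have h1 := hsucc i
    have h2 : off (i + 1) ≤ off r := hmono hi
    change size i ≤ _
    omega
  · intro x hx y hy hxy
    have key : ∀ x y, H.slot x = H.slot y → hash p r a x ≤ hash p r a y := by
      intro x y hxy
      by_contra! h
      have h1 := hslot y
      have h2 : off (hash p r a y + 1) ≤ off (hash p r a x) := hmono h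
      have h3 : off (hash p r a x) ≤ H.slot x := Nat.le_add_right _ _
      omega
    have hi : hash p r a x = hash p r a y := le_antisymm (key x y hxy) (key y x hxy.symm)
    refine hinj (hash p r a y) ?_ ?_ ?_
    · simp [hi]; exact hx
    · simp; exact hy
    · simp only [HashTable.slot, hH, hi] at hxy
      exact Nat.add_left_cancel hxy

end ADO

namespace ADO

/-! ### A small set of centres with small clusters -/

section Cluster

variable {V L : Type*} [Fintype V] [DecidableEq V] [LinearOrder L] (f : V → V → L)

/-- The points that are closer to `w` than to all the centres `a ∈ A`. -/
def cluster (A : Finset V) (w : V) : Finset V :=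
  {u | ∀ a ∈ A, f u w < f u a}

theorem mem_cluster {A : Finset V} {u w : V} :
    u ∈ cluster f A w ↔ ∀ a ∈ A, f u w < f u a := by simp [cluster]

/-- Clusters are defined by strict inequality, so a new centre x also removes the points that are
equally far from x and w. -/
theorem card_cluster_insert (A : Finset V) (x w : V) :
    (cluster f (insert x A) w).card + {u ∈ cluster f A w | f u x ≤ f u w}.card =
      (cluster f A w).card := by
  rw [add_comm, ← Finset.card_filter_add_card_filter_not (s := cluster f A w)
    (p := fun u => f u x ≤ f u w)]
  congr 2
  ext u
  simp only [mem_cluster, Finset.mem_filter, Finset.mem_insert, forall_eq_or_imp, not_le]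
  tauto

theorem card_cluster_insert_le (A : Finset V) (x w : V) :
    (cluster f (insert x A) w).card ≤ (cluster f A w).card := by
  rw [← card_cluster_insert f A x w]; exact Nat.le_add_right _ _

/-- The decrease of the sum of the squares when a centre is added, averaged over the new centre with
weights proportional to the sizes of the clusters. -/
theorem sq_sum_card_cluster_sq_le (A : Finset V) :
    (∑ w, ((cluster f A w).card : ℝ) ^ 2) ^ 2 ≤ 2 * Fintype.card V *
      ∑ x, (cluster f A x).card * (∑ w, ((cluster f A w).card : ℝ) ^ 2 -
        ∑ w, ((cluster f (insert x A) w).card : ℝ) ^ 2) := by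
  set c : V → ℝ := fun w => ((cluster f A w).card : ℝ) with hc
  set b : V → V → ℝ := fun u w => if u ∈ cluster f A w then 1 else 0 with hb
  set S : V → ℝ := fun u => ∑ w, b u w * c w with hS
  have hb0 : ∀ u w, 0 ≤ b u w := fun u w => by simp only [hb]; split_ifs <;> norm_num
  have hb1 : ∀ u w, b u w ≤ 1 := fun u w => by simp only [hb]; split_ifs <;> norm_num
  have hc0 : ∀ w, 0 ≤ c w := fun w => Nat.cast_nonneg _
  have hbc : ∀ w, ∑ u, b u w = c w := fun w => by simp [hb, hc]
  have hsumS : ∑ u, S u = ∑ w, c w ^ 2 := by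
    simp only [hS]
    rw [Finset.sum_comm]
    refine Finset.sum_congr rfl fun w _ => ?_
    rw [← Finset.sum_mul, hbc, sq]
  -- This indicates that u leaves the cluster of w when x becomes a centre. For any x and w, at
  -- least one of them as a centre would expel u from the cluster of the other.
  set e : V → V → V → ℝ := fun u x w => if f u x ≤ f u w then 1 else 0 with he
  have he1 : ∀ u x w, 1 ≤ e u x w + e u w x := fun u x w => by
    simp only [he]
    rcases le_total (f u x) (f u w) with h | h <;> simp only [h, if_true] <;> split_ifs <;> norm_num
  -- If a cluster shrinks from c to c', then c² - c'² = (c - c')(c + c') ≥ c (c - c').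
  have hdrop : ∀ x w, c w * ∑ u, b u w * e u x w ≤
      c w ^ 2 - ((cluster f (insert x A) w).card : ℝ) ^ 2 := by
    intro x w
    have h1 : ∑ u, b u w * e u x w = ({u ∈ cluster f A w | f u x ≤ f u w}.card : ℝ) := by
      simp only [hb, he, Finset.card_filter, Nat.cast_sum, Finset.sum_ite_mem, ite_mul, one_mul,
        zero_mul, Finset.univ_inter]
      push_cast; rfl
    have h2 : ((cluster f (insert x A) w).card : ℝ) +
        ({u ∈ cluster f A w | f u x ≤ f u w}.card : ℝ) = c w := by
      simp only [hc]; exact_mod_cast card_cluster_insert f A x w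
    rw [h1, ← h2]
    nlinarith [mul_nonneg (Nat.cast_nonneg (α := ℝ) (cluster f (insert x A) w).card)
      (Nat.cast_nonneg (α := ℝ) {u ∈ cluster f A w | f u x ≤ f u w}.card)]
  -- Symmetrization in x and w: the inequality `he1` costs only the factor 2.
  have hSq : ∑ u, S u ^ 2 ≤ 2 * ∑ u, ∑ x, ∑ w, c x * c w * (b u w * e u x w) := by
    rw [Finset.mul_sum]
    gcongr with u
    have hsw : ∑ x, ∑ w, c x * c w * (b u x * b u w * e u w x) =
        ∑ x, ∑ w, c x * c w * (b u x * b u w * e u x w) := by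
      rw [Finset.sum_comm]
      refine Finset.sum_congr rfl fun x _ => Finset.sum_congr rfl fun w _ => ?_
      ring
    calc S u ^ 2 = ∑ x, ∑ w, c x * c w * (b u x * b u w) := by
          simp only [hS]
          rw [sq, Finset.sum_mul_sum]
          refine Finset.sum_congr rfl fun x _ => Finset.sum_congr rfl fun w _ => ?_
          ring
      _ ≤ ∑ x, ∑ w, (c x * c w * (b u x * b u w * e u x w) +
            c x * c w * (b u x * b u w * e u w x)) := by
          gcongr with x _ w _
          rw [← mul_add, ← mul_add]
          exact mul_le_mul_of_nonneg_left (le_mul_of_one_le_right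
            (mul_nonneg (hb0 _ _) (hb0 _ _)) (he1 _ _ _)) (mul_nonneg (hc0 _) (hc0 _))
      _ = 2 * ∑ x, ∑ w, c x * c w * (b u x * b u w * e u x w) := by
          simp_rw [Finset.sum_add_distrib]
          rw [hsw, two_mul]
      _ ≤ 2 * ∑ x, ∑ w, c x * c w * (b u w * e u x w) := by
          gcongr with x _ w _
          exact mul_le_of_le_one_left (hb0 _ _) (hb1 _ _)
  calc _ = (∑ u, S u) ^ 2 := by rw [hsumS]
    _ ≤ Fintype.card V * ∑ u, S u ^ 2 := sq_sum_le_card_mul_sum_sq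
    _ ≤ Fintype.card V * (2 * ∑ u, ∑ x, ∑ w, c x * c w * (b u w * e u x w)) := by gcongr
    _ = 2 * Fintype.card V * ∑ x, c x * ∑ w, c w * ∑ u, b u w * e u x w := by
        rw [Finset.sum_comm]
        simp_rw [Finset.mul_sum]
        rw [Finset.sum_congr rfl fun x _ => Finset.sum_comm]
        refine Finset.sum_congr rfl fun x _ => Finset.sum_congr rfl fun w _ =>
          Finset.sum_congr rfl fun u _ => ?_
        ring
    _ ≤ 2 * Fintype.card V * ∑ x, c x * (∑ w, c w ^ 2 -
          ∑ w, ((cluster f (insert x A) w).card : ℝ) ^ 2) := by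
        gcongr with x _
        rw [← Finset.sum_sub_distrib]
        gcongr with w _
        exact hdrop x w

/-- Some x does at least as well as the weighted average. Points with empty clusters have weight
zero and are discarded, so that the weight of x can be cancelled. -/
theorem exists_insert_sum_card_cluster_sq_le (A : Finset V)
    (hA : 0 < ∑ w, ((cluster f A w).card : ℝ) ^ 2) :
    ∃ x, (∑ w, ((cluster f A w).card : ℝ) ^ 2) ^ 2 ≤
      2 * Fintype.card V * (∑ w, ((cluster f A w).card : ℝ)) *
        (∑ w, ((cluster f A w).card : ℝ) ^ 2 -
          ∑ w, ((cluster f (insert x A) w).card : ℝ) ^ 2) := by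
  set M := ∑ w, ((cluster f A w).card : ℝ) ^ 2 with hM
  set s : Finset V := {w | (cluster f A w).card ≠ 0} with hs
  have hne : s.Nonempty := by
    obtain ⟨w, -, hw⟩ := Finset.exists_ne_zero_of_sum_ne_zero hA.ne'
    exact ⟨w, by simpa [hs] using hw⟩
  have hsum : ∀ g : V → ℝ, ∑ x ∈ s, (cluster f A x).card * g x =
      ∑ x, (cluster f A x).card * g x := by
    refine fun g => Finset.sum_subset (Finset.subset_univ _) fun x _ hx => ?_
    have : (cluster f A x).card = 0 := by
      by_contra h
      exact hx (by simpa [hs] using h)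
    rw [this]; simp
  obtain ⟨x, hx, h⟩ := Finset.exists_le_of_sum_le hne
    (f := fun x => (cluster f A x).card * M ^ 2)
    (g := fun x => (cluster f A x).card *
      (2 * Fintype.card V * (∑ w, ((cluster f A w).card : ℝ)) *
        (M - ∑ w, ((cluster f (insert x A) w).card : ℝ) ^ 2))) (by
      rw [hsum, hsum, ← Finset.sum_mul]
      calc _ ≤ (∑ x, ((cluster f A x).card : ℝ)) * _ :=
            mul_le_mul_of_nonneg_left (sq_sum_card_cluster_sq_le f A)
              (Finset.sum_nonneg fun _ _ => Nat.cast_nonneg _)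
        _ = _ := by
            rw [mul_left_comm, ← mul_assoc, Finset.mul_sum]
            exact Finset.sum_congr rfl fun x _ => mul_left_comm _ _ _)
  refine ⟨x, le_of_mul_le_mul_left h ?_⟩
  have : (cluster f A x).card ≠ 0 := by simpa [hs] using hx
  positivity

/-- The hypothesis gives z'² ≤ z²(1 - z/2N) ≤ z²(1 - z/4N)², hence z' ≤ z(1 - z/4N) ≤ z/(1 + z/4N):
the quantity 4N/z grows by at least 1 per step. -/
theorem succ_mul_le_of_sq_le {z z' N k : ℝ} (hN : 0 < N) (hz : 0 < z) (hz' : 0 ≤ z')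
    (hkz : k * z ≤ 4 * N) (h : z ^ 3 ≤ 2 * N * (z ^ 2 - z' ^ 2)) : (k + 1) * z' ≤ 4 * N := by
  have h1 : z ≤ 2 * N := by
    have : z ^ 2 * z ≤ z ^ 2 * (2 * N) := by nlinarith [mul_nonneg hN.le (sq_nonneg z')]
    exact le_of_mul_le_mul_left this (by positivity)
  have h2 : 4 * N * z' ≤ z * (4 * N - z) := by
    refine abs_le_of_sq_le_sq' ?_ (mul_nonneg hz.le (by linarith)) |>.2
    have : (4 * N * z') ^ 2 ≤ 8 * N * (2 * N * z ^ 2 - z ^ 3) := by nlinarith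
    nlinarith [sq_nonneg (z ^ 2)]
  have h3 : (4 * N + z) * z' ≤ 4 * N * z := by
    refine le_of_mul_le_mul_left (a := 4 * N) ?_ (by positivity)
    nlinarith [mul_le_mul_of_nonneg_left h2 (show 0 ≤ 4 * N + z by positivity), pow_pos hz 3]
  refine le_of_mul_le_mul_left (a := z) ?_ hz
  nlinarith

theorem exists_card_le_sum_card_cluster_sq_le (k : ℕ) :
    ∃ A : Finset V, A.card ≤ k ∧
      (k : ℝ) ^ 2 * ∑ w, ((cluster f A w).card : ℝ) ^ 2 ≤ 16 * (Fintype.card V : ℝ) ^ 3 := by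
  rcases isEmpty_or_nonempty V with hV | hV
  · exact ⟨∅, by simp, by simp⟩
  set n : ℝ := (Fintype.card V : ℝ) with hn
  have hn0 : 0 < n := by simp only [hn]; exact_mod_cast Fintype.card_pos
  set M : Finset V → ℝ := fun A => ∑ w, ((cluster f A w).card : ℝ) ^ 2 with hM
  have hM0 : ∀ A, 0 ≤ M A := fun A => Finset.sum_nonneg fun _ _ => sq_nonneg _
  -- The root mean square cluster size. Cauchy-Schwarz bounds the sum of the sizes by n z, which
  -- turns the greedy step into z³ ≤ 2n(z² - z'²).
  set z : Finset V → ℝ := fun A => √(M A / n) with hz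
  have hzM : ∀ A, n * z A ^ 2 = M A := fun A => by
    simp only [hz]
    rw [Real.sq_sqrt (div_nonneg (hM0 A) hn0.le)]
    field_simp
  suffices h : ∃ A : Finset V, A.card ≤ k ∧ k * z A ≤ 4 * n by
    obtain ⟨A, hA, h⟩ := h
    refine ⟨A, hA, ?_⟩
    change (k : ℝ) ^ 2 * M A ≤ _
    rw [← hzM A]
    have : (k * z A) ^ 2 ≤ (4 * n) ^ 2 :=
      pow_le_pow_left₀ (mul_nonneg (Nat.cast_nonneg _) (Real.sqrt_nonneg _)) h 2
    nlinarith
  induction k with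
  | zero => exact ⟨∅, by simp, by rw [Nat.cast_zero, zero_mul]; linarith⟩
  | succ k ih =>
    obtain ⟨A, hA, h⟩ := ih
    have hz0 : 0 ≤ z A := Real.sqrt_nonneg _
    rcases hz0.eq_or_lt with h0 | h0
    · exact ⟨A, by omega, by rw [← h0, mul_zero]; linarith⟩
    obtain ⟨x, hx⟩ := exists_insert_sum_card_cluster_sq_le f A (by
      change 0 < M A
      rw [← hzM A]; exact mul_pos hn0 (pow_pos h0 2))
    change M A ^ 2 ≤ 2 * n * (∑ w, ((cluster f A w).card : ℝ)) * (M A - M (insert x A)) at hx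
    have hdec : 0 ≤ M A - M (insert x A) := by
      rw [sub_nonneg]
      refine Finset.sum_le_sum fun w _ => ?_
      have := card_cluster_insert_le f A x w
      gcongr
    have hM1 : (∑ w, ((cluster f A w).card : ℝ)) ≤ n * z A := by
      refine abs_le_of_sq_le_sq' ?_ (mul_nonneg hn0.le hz0) |>.2
      have : (∑ w, ((cluster f A w).card : ℝ)) ^ 2 ≤ n * M A := sq_sum_le_card_mul_sum_sq
      rw [← hzM A] at this
      nlinarith
    refine ⟨insert x A, (Finset.card_insert_le _ _).trans (by omega), ?_⟩
    push_cast
    refine succ_mul_le_of_sq_le hn0 h0 (Real.sqrt_nonneg _) h ?_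
    have h1 : M A ^ 2 ≤ 2 * n * (n * z A) * (M A - M (insert x A)) := hx.trans
      (mul_le_mul_of_nonneg_right (mul_le_mul_of_nonneg_left hM1 (by linarith)) hdec)
    rw [← hzM A, ← hzM (insert x A)] at h1
    refine le_of_mul_le_mul_left (a := n ^ 2 * z A) ?_ (mul_pos (pow_pos hn0 2) h0)
    nlinarith

end Cluster

end ADO

namespace ADO

/-! ### The query program -/

namespace QueryExpr

/-- The expression that selects `x` if `b` is `1` and `y` if `b` is `0`. -/
def sel (b x y : QueryExpr) : QueryExpr :=
  .op .add (.op .mul b x) (.op .mul (.op .sub (.num 1) b) y)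

/-- `1` if the operands are equal and `0` otherwise. -/
def eq (x y : QueryExpr) : QueryExpr :=
  sel (.op .lt x y) (.num 0) (sel (.op .lt y x) (.num 0) (.num 1))

def min (x y : QueryExpr) : QueryExpr := sel (.op .lt x y) x y

/-- The memory is an array of records with `16` fields; this is field `j` of record `i`. -/
def field (j : ℕ) (i : QueryExpr) : QueryExpr :=
  .load (.op .add (.op .mul (.num 16) i) (.num j))

def hash (p r a x : QueryExpr) : QueryExpr := .op .mod (.op .mod (.op .mul a x) p) r

/-- The number of vertices. -/
def size : QueryExpr := field 0 (.num 0)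

/-- The slot of a key in the hash table. -/
def slot (x : QueryExpr) : QueryExpr :=
  let i := hash (field 1 (.num 0)) (field 3 (.num 0)) (field 2 (.num 0)) x
  .op .add (field 4 i) (hash (field 1 (.num 0)) (field 6 i) (field 5 i) x)

/-- The stored distance of a pair, or `2 * n` if there is none. -/
def dist (u v : QueryExpr) : QueryExpr :=
  let x := .op .add (.op .mul u size) v
  sel (eq (field 7 (slot x)) (.op .add x (.num 1))) (field 8 (slot x)) (.op .add size size)

/-- The length of the path through the vertex `a`. -/
def detour (a : QueryExpr) : QueryExpr := .op .add (dist a .fst) (dist a .snd)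

def estimate : QueryExpr :=
  min (dist .fst .snd) (min (detour (field 9 .fst)) (detour (field 9 .snd)))

/-- The estimate, where the values from `2 * n` on are replaced by the word for `∞`. -/
def query : QueryExpr :=
  sel (.op .lt estimate (.op .add size size)) estimate (.op .sub (.num 0) (.num 1))

/-- The value of `e` is the number `m`. -/
def Computes {w : ℕ} (mem : List (BitVec w)) (x y : BitVec w) (e : QueryExpr) (m : ℕ) : Prop :=
  (e.eval mem x y).toNat = m

variable {w : ℕ} {mem : List (BitVec w)} {x y : BitVec w} {a b c : QueryExpr} {k l m : ℕ}

theorem computes_num (hk : k < 2 ^ w) : Computes mem x y (.num k) k := by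
  simp [Computes, eval, Nat.mod_eq_of_lt hk]

theorem Computes.add (ha : Computes mem x y a k) (hb : Computes mem x y b l)
    (h : k + l < 2 ^ w) : Computes mem x y (.op .add a b) (k + l) := by
  unfold Computes at *
  simp [eval, Op.eval, ha, hb, Nat.mod_eq_of_lt h]

theorem Computes.mul (ha : Computes mem x y a k) (hb : Computes mem x y b l)
    (h : k * l < 2 ^ w) : Computes mem x y (.op .mul a b) (k * l) := by
  unfold Computes at *
  simp [eval, Op.eval, ha, hb, Nat.mod_eq_of_lt h]

theorem Computes.mod (ha : Computes mem x y a k) (hb : Computes mem x y b l) :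
    Computes mem x y (.op .mod a b) (k % l) := by
  unfold Computes at *
  simp [eval, Op.eval, ha, hb]

theorem Computes.lt (hw : 0 < w) (ha : Computes mem x y a k) (hb : Computes mem x y b l) :
    Computes mem x y (.op .lt a b) (if k < l then 1 else 0) := by
  unfold Computes at *
  simp only [eval, Op.eval, ha, hb]
  split_ifs
  · simp [Nat.mod_eq_of_lt (Nat.one_lt_two_pow hw.ne')]
  · simp

theorem Computes.sel {p : Prop} [Decidable p] (hw : 0 < w)
    (hc : Computes mem x y c (if p then 1 else 0))
    (ha : Computes mem x y a k) (hb : Computes mem x y b l) :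
    Computes mem x y (sel c a b) (if p then k else l) := by
  have h1 : (1 : ℕ) % 2 ^ w = 1 := Nat.mod_eq_of_lt (Nat.one_lt_two_pow hw.ne')
  unfold Computes at *
  split_ifs at hc ⊢ with hp
  · have : c.eval mem x y = 1 := BitVec.eq_of_toNat_eq (by rw [hc]; simp [h1])
    rw [← ha, QueryExpr.sel]
    simp only [eval, Op.eval, this]
    congr 1
    change 1 * _ + (1 - 1) * _ = _
    ring
  · have : c.eval mem x y = 0 := BitVec.eq_of_toNat_eq (by rw [hc]; simp)
    rw [← hb, QueryExpr.sel]
    simp only [eval, Op.eval, this]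
    congr 1
    change 0 * _ + (1 - 0) * _ = _
    ring

theorem Computes.eq (hw : 0 < w) (ha : Computes mem x y a k) (hb : Computes mem x y b l) :
    Computes mem x y (eq a b) (if k = l then 1 else 0) := by
  have h1 : 1 < 2 ^ w := Nat.one_lt_two_pow hw.ne'
  have h := (ha.lt hw hb).sel hw (computes_num (k := 0) (by omega))
    ((hb.lt hw ha).sel hw (computes_num (k := 0) (by omega)) (computes_num h1))
  rwa [show (if k < l then 0 else if l < k then 0 else 1) = if k = l then 1 else 0 by
    split_ifs <;> omega] at h

theorem Computes.min (hw : 0 < w) (ha : Computes mem x y a k) (hb : Computes mem x y b l) :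
    Computes mem x y (min a b) (Min.min k l) := by
  have h := (ha.lt hw hb).sel hw ha hb
  rwa [show (if k < l then k else l) = Min.min k l by split_ifs <;> omega] at h

theorem Computes.hash {p r : QueryExpr} {pn rn : ℕ} (hp : Computes mem x y p pn)
    (hr : Computes mem x y r rn) (ha : Computes mem x y a k) (hb : Computes mem x y b l)
    (h : k * l < 2 ^ w) : Computes mem x y (hash p r a b) (ADO.hash pn rn k l) :=
  ((ha.mul hb h).mod hp).mod hr

end QueryExpr

/-! ### The contents of the memory -/

/-- The contents of the arrays that are stored. -/
structure Content where
  n : ℕ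
  table : HashTable
  /-- the successor of the key in a slot, or `0` if the slot is empty -/
  key : ℕ → ℕ
  /-- the value of the key in a slot -/
  val : ℕ → ℕ
  /-- the pivot of a vertex -/
  pivot : ℕ → ℕ

namespace Content

def field (M : Content) (i : ℕ) : ℕ → ℕ
  | 0 => M.n
  | 1 => M.table.p
  | 2 => M.table.a
  | 3 => M.table.r
  | 4 => M.table.off i
  | 5 => M.table.mult i
  | 6 => M.table.size i
  | 7 => M.key i
  | 8 => M.val i
  | 9 => M.pivot i
  | _ => 0

/-- The memory with `L` records. -/
def memory (M : Content) (w L : ℕ) : List (BitVec w) :=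
  List.ofFn fun m : Fin (16 * L) => BitVec.ofNat w (M.field (m / 16) (m % 16))

@[simp]
theorem length_memory (M : Content) (w L : ℕ) : (M.memory w L).length = 16 * L :=
  List.length_ofFn

open QueryExpr

theorem computes_field (M : Content) {w L : ℕ} {x y : BitVec w} {e : QueryExpr} {i j : ℕ}
    (hL : 16 * L < 2 ^ w) (hi : i < L) (hj : j < 16) (hM : M.field i j < 2 ^ w)
    (he : Computes (M.memory w L) x y e i) :
    Computes (M.memory w L) x y (QueryExpr.field j e) (M.field i j) := by
  have h := ((computes_num (k := 16) (by omega)).mul he (by omega)).add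
    (computes_num (k := j) (by omega)) (by omega)
  unfold Computes at h ⊢
  rw [QueryExpr.field, eval, h, List.getD_eq_getElem _ _ (by simp; omega)]
  simp only [memory, List.getElem_ofFn, BitVec.toNat_ofNat]
  rw [show (16 * i + j) / 16 = i by omega, show (16 * i + j) % 16 = j by omega,
    Nat.mod_eq_of_lt hM]

/-- The contents fit into words of length `w` and `L` records. -/
structure Fits (M : Content) (w L : ℕ) : Prop where
  n_pos : 0 < M.n
  n_le : M.n ≤ L
  bounded : M.table.Bounded L
  L_lt : 16 * L < 2 ^ w
  p_sq_lt : M.table.p ^ 2 < 2 ^ w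
  sq_le : M.n ^ 2 ≤ M.table.p
  p_pos : 1 < M.table.p
  key_le : ∀ i, M.key i ≤ M.table.p
  val_le : ∀ i, M.val i ≤ 2 * M.n
  pivot_lt : ∀ i, M.pivot i < M.n

variable {M : Content} {w L : ℕ} {x y : BitVec w}

namespace Fits

theorem p_lt (hM : M.Fits w L) : M.table.p < 2 ^ w :=
  (Nat.le_self_pow two_ne_zero _).trans_lt hM.p_sq_lt

theorem L_pos (hM : M.Fits w L) : 0 < L := hM.n_pos.trans_le hM.n_le

theorem w_pos (hM : M.Fits w L) : 0 < w := by
  by_contra h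
  have h1 := hM.L_lt
  have h2 := hM.L_pos
  obtain rfl : w = 0 := by omega
  omega

theorem computes_const (hM : M.Fits w L) {j : ℕ} (hj : j < 16) (h : M.field 0 j < 2 ^ w) :
    Computes (M.memory w L) x y (QueryExpr.field j (.num 0)) (M.field 0 j) :=
  M.computes_field hM.L_lt hM.L_pos hj h (computes_num (by positivity))

theorem computes_size (hM : M.Fits w L) : Computes (M.memory w L) x y QueryExpr.size M.n := by
  have h1 := hM.L_lt
  have h2 := hM.n_le
  exact hM.computes_const (by norm_num) (show M.n < 2 ^ w by omega)

theorem computes_slot (hM : M.Fits w L) {e : QueryExpr} {k : ℕ} (hk : k < M.table.p)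
    (he : Computes (M.memory w L) x y e k) :
    Computes (M.memory w L) x y (QueryExpr.slot e) (M.table.slot k) := by
  have hp := hM.p_lt
  have hL := hM.L_lt
  have hB := hM.bounded
  have hmul : ∀ a < M.table.p, a * k < 2 ^ w := fun a ha =>
    (Nat.mul_le_mul ha.le hk.le).trans_lt (by rw [← sq]; exact hM.p_sq_lt)
  have hr := hB.r_le
  have ha := hB.a_lt
  have cp : Computes (M.memory w L) x y (QueryExpr.field 1 (.num 0)) M.table.p :=
    hM.computes_const (by norm_num) hp
  have cr : Computes (M.memory w L) x y (QueryExpr.field 3 (.num 0)) M.table.r :=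
    hM.computes_const (by norm_num) (show M.table.r < 2 ^ w by omega)
  have ca : Computes (M.memory w L) x y (QueryExpr.field 2 (.num 0)) M.table.a :=
    hM.computes_const (by norm_num) (show M.table.a < 2 ^ w by omega)
  have ci := cp.hash cr ca he (hmul _ ha)
  set i := ADO.hash M.table.p M.table.r M.table.a k
  have hi : i < M.table.r := Nat.mod_lt _ hB.r_pos
  have h4 := hB.off_le i hi
  have h5 := hB.mult_lt i
  have h6 := hB.size_le i hi
  have c4 := M.computes_field hL (by omega) (j := 4) (by norm_num)
    (show M.table.off i < 2 ^ w by omega) ci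
  have c5 := M.computes_field hL (by omega) (j := 5) (by norm_num)
    (show M.table.mult i < 2 ^ w by omega) ci
  have c6 := M.computes_field hL (by omega) (j := 6) (by norm_num)
    (show M.table.size i < 2 ^ w by omega) ci
  have hs := hB.slot_lt k
  exact c4.add (cp.hash c6 c5 he (hmul _ h5)) (show M.table.slot k < 2 ^ w by omega)

/-- The value of the key `k`, or `2 * n` if `k` is not a key. -/
def _root_.ADO.Content.lookup (M : Content) (k : ℕ) : ℕ :=
  if M.key (M.table.slot k) = k + 1 then M.val (M.table.slot k) else 2 * M.n

theorem lookup_le (hM : M.Fits w L) (k : ℕ) : M.lookup k ≤ 2 * M.n := by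
  unfold lookup
  split_ifs
  exacts [hM.val_le _, le_rfl]

theorem four_mul_lt (hM : M.Fits w L) : 4 * M.n < 2 ^ w := by
  have h1 := hM.L_lt
  have h2 := hM.n_le
  omega

theorem key_lt (hM : M.Fits w L) {u v : ℕ} (hu : u < M.n) (hv : v < M.n) :
    u * M.n + v < M.n ^ 2 := by
  have : (u + 1) * M.n ≤ M.n * M.n := Nat.mul_le_mul_right _ hu
  rw [sq]
  have := hM.n_pos
  linarith

theorem computes_dist (hM : M.Fits w L) {a b : QueryExpr} {u v : ℕ} (hu : u < M.n) (hv : v < M.n)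
    (ha : Computes (M.memory w L) x y a u) (hb : Computes (M.memory w L) x y b v) :
    Computes (M.memory w L) x y (QueryExpr.dist a b) (M.lookup (u * M.n + v)) := by
  have hp := hM.p_lt
  have hL := hM.L_lt
  have hw := hM.w_pos
  have hn := hM.four_mul_lt
  have hk := (hM.key_lt hu hv).trans_le hM.sq_le
  have h2p : M.table.p + 1 < 2 ^ w := by
    have := hM.p_sq_lt
    have := hM.p_pos
    nlinarith
  have cx := (ha.mul hM.computes_size (by omega)).add hb (by omega)
  have cs := hM.computes_slot hk cx
  have hs := hM.bounded.slot_lt (u * M.n + v)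
  have hkey := hM.key_le (M.table.slot (u * M.n + v))
  have hval := hM.val_le (M.table.slot (u * M.n + v))
  have c7 := M.computes_field hL hs (j := 7) (by norm_num)
    (show M.key _ < 2 ^ w by omega) cs
  have c8 := M.computes_field hL hs (j := 8) (by norm_num)
    (show M.val _ < 2 ^ w by omega) cs
  have h := (c7.eq hw (cx.add (computes_num (k := 1) (by omega)) (by omega))).sel hw c8
    (hM.computes_size.add hM.computes_size (by omega))
  rw [← two_mul] at h
  exact h

theorem computes_query (hM : M.Fits w L) {u v : ℕ} (hu : u < M.n) (hv : v < M.n)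
    (hx : x.toNat = u) (hy : y.toNat = v) {e : ℕ}
    (he : e = min (M.lookup (u * M.n + v))
      (min (M.lookup (M.pivot u * M.n + u) + M.lookup (M.pivot u * M.n + v))
        (M.lookup (M.pivot v * M.n + u) + M.lookup (M.pivot v * M.n + v)))) :
    Computes (M.memory w L) x y QueryExpr.query (if e < 2 * M.n then e else 2 ^ w - 1) := by
  have hw := hM.w_pos
  have hL := hM.L_lt
  have hn := hM.four_mul_lt
  have hnL := hM.n_le
  have cx : Computes (M.memory w L) x y .fst u := hx
  have cy : Computes (M.memory w L) x y .snd v := hy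
  have hpiv := hM.pivot_lt
  have cpiv : ∀ {b : QueryExpr} {z : ℕ}, z < M.n → Computes (M.memory w L) x y b z →
      Computes (M.memory w L) x y (QueryExpr.field 9 b) (M.pivot z) := fun {b z} hz hb =>
    M.computes_field hL (by omega) (j := 9) (by norm_num)
      (show M.pivot _ < 2 ^ w by have := hpiv z; omega) hb
  have hl := hM.lookup_le
  have cdet : ∀ {b : QueryExpr} {z : ℕ}, z < M.n → Computes (M.memory w L) x y b z →
      Computes (M.memory w L) x y (QueryExpr.detour b)
        (M.lookup (z * M.n + u) + M.lookup (z * M.n + v)) := fun {b z} hz hb =>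
    (hM.computes_dist hz hu hb cx).add (hM.computes_dist hz hv hb cy) (by
      have := hl (z * M.n + u); have := hl (z * M.n + v); omega)
  have ce := (hM.computes_dist hu hv cx cy).min hw ((cdet (hpiv u) (cpiv hu cx)).min hw
    (cdet (hpiv v) (cpiv hv cy)))
  rw [← he] at ce
  have cinf : Computes (M.memory w L) x y (.op .sub (.num 0) (.num 1)) (2 ^ w - 1) := by
    unfold Computes
    simp [eval, Op.eval, Nat.mod_eq_of_lt (Nat.one_lt_two_pow hw.ne')]
  have h := (ce.lt hw (hM.computes_size.add hM.computes_size (by omega))).sel hw ce cinf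
  rw [← two_mul] at h
  exact h

end Fits

end Content

end ADO

/-! ### Realizing a set of stored distances in memory -/

namespace ADO

-- A slot records the successor of its key, so 0 marks an empty slot and the comparison with k + 1
-- fails for every k outside S.
open Classical in
theorem exists_key_val {S : Finset ℕ} {slot : ℕ → ℕ} (hS : Set.InjOn slot S) {p q : ℕ}
    (hp : ∀ x ∈ S, x < p) {D : ℕ → ℕ} (hD : ∀ x ∈ S, D x ≤ q) :
    ∃ key val : ℕ → ℕ, (∀ k, (if key (slot k) = k + 1 then val (slot k) else q) =
      if k ∈ S then D k else q) ∧ (∀ i, key i ≤ p) ∧ ∀ i, val i ≤ q := by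
  have hex : ∀ i, ∃ kv : ℕ × ℕ, (∀ k ∈ S, slot k = i → kv = (k + 1, D k)) ∧
      ((∀ k ∈ S, slot k ≠ i) → kv = (0, 0)) := by
    intro i
    by_cases h : ∃ k ∈ S, slot k = i
    · obtain ⟨k, hk, rfl⟩ := h
      refine ⟨(k + 1, D k), fun l hl hlk => ?_, fun h => absurd rfl (h k hk)⟩
      rw [hS hl hk hlk]
    · push Not at h
      exact ⟨(0, 0), fun k hk hki => absurd hki (h k hk), fun _ => rfl⟩
  choose kv h1 h2 using hex
  have h3 : ∀ i, (kv i = (0, 0)) ∨ ∃ k ∈ S, kv i = (k + 1, D k) := by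
    intro i
    by_cases h : ∃ k ∈ S, slot k = i
    · obtain ⟨k, hk, hki⟩ := h
      exact Or.inr ⟨k, hk, h1 i k hk hki⟩
    · push Not at h
      exact Or.inl (h2 i h)
  refine ⟨fun i => (kv i).1, fun i => (kv i).2, fun k => ?_, fun i => ?_, fun i => ?_⟩
  · by_cases hk : k ∈ S
    · simp [hk, h1 (slot k) k hk rfl]
    · rw [if_neg hk]
      rcases h3 (slot k) with h | ⟨l, hl, h⟩
      · simp [h]
      · refine if_neg fun h' => hk ?_
        dsimp only at h'
        rw [h] at h'
        obtain rfl : l = k := Nat.succ_injective h'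
        exact hl
  · rcases h3 i with h | ⟨l, hl, h⟩ <;> simp only [h]
    · omega
    · exact hp l hl
  · rcases h3 i with h | ⟨l, hl, h⟩ <;> simp only [h]
    · omega
    · exact hD l hl

section Stored

variable {n : ℕ} (G : SimpleGraph (Fin n)) (S : Finset (Fin n × Fin n)) (pivot : Fin n → Fin n)

/-- The distance of a pair in `S`, and `⊤` for the other pairs. -/
noncomputable def storedDist (u v : Fin n) : ℕ∞ := if (u, v) ∈ S then G.edist u v else ⊤

/-- The estimate that is computed from the distances of the pairs in `S`. -/
noncomputable def storedEstimate (u v : Fin n) : ℕ∞ :=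
  min (storedDist G S u v)
    (min (storedDist G S (pivot u) u + storedDist G S (pivot u) v)
      (storedDist G S (pivot v) u + storedDist G S (pivot v) v))

end Stored

/-- The number `m` stands for `a`, where the numbers from `b` on stand for `⊤`. -/
def Encodes (b : ℕ) (a : ℕ∞) (m : ℕ) : Prop := (a = m ∧ m < b) ∨ (a = ⊤ ∧ b ≤ m)

theorem Encodes.min {b k l : ℕ} {x y : ℕ∞} (hx : Encodes b x k) (hy : Encodes b y l) :
    Encodes b (min x y) (min k l) := by
  rcases hx with ⟨rfl, hk⟩ | ⟨rfl, hk⟩ <;> rcases hy with ⟨rfl, hl⟩ | ⟨rfl, hl⟩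
  · exact Or.inl ⟨by norm_cast, by omega⟩
  · exact Or.inl ⟨by rw [min_eq_left le_top, min_eq_left (by omega)], by omega⟩
  · exact Or.inl ⟨by rw [min_eq_right le_top, min_eq_right (by omega)], by omega⟩
  · exact Or.inr ⟨by simp, by omega⟩

/-- `m` stands for the distance `a` in a graph with `n` vertices. -/
def EncodesDist (n : ℕ) (a : ℕ∞) (m : ℕ) : Prop := (a = m ∧ m < n) ∨ (a = ⊤ ∧ m = 2 * n)

theorem EncodesDist.encodes {n m : ℕ} {a : ℕ∞} (h : EncodesDist n a m) : Encodes (2 * n) a m := by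
  rcases h with ⟨h, hm⟩ | ⟨h, hm⟩
  · exact Or.inl ⟨h, by omega⟩
  · exact Or.inr ⟨h, hm.ge⟩

/-- Finite distances are below n, so two of them sum to less than 2n, while one infinite summand
already contributes 2n. -/
theorem EncodesDist.add {n k l : ℕ} {x y : ℕ∞} (hx : EncodesDist n x k) (hy : EncodesDist n y l) :
    Encodes (2 * n) (x + y) (k + l) := by
  rcases hx with ⟨rfl, hk⟩ | ⟨rfl, hk⟩ <;> rcases hy with ⟨rfl, hl⟩ | ⟨rfl, hl⟩
  · exact Or.inl ⟨by norm_cast, by omega⟩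
  all_goals exact Or.inr ⟨by simp, by omega⟩

theorem exists_encodesDist_edist {n : ℕ} (G : SimpleGraph (Fin n)) (u v : Fin n) :
    ∃ m, EncodesDist n (G.edist u v) m := by
  by_cases h : G.edist u v = ⊤
  · exact ⟨2 * n, Or.inr ⟨h, rfl⟩⟩
  · obtain ⟨p, hp, hl⟩ :=
      (SimpleGraph.edist_ne_top_iff_reachable.mp h).exists_path_of_dist
    refine ⟨G.dist u v, Or.inl
      ⟨(SimpleGraph.edist_ne_top_iff_reachable.mp h).coe_dist_eq_edist.symm, ?_⟩⟩
    rw [← hl]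
    simpa using hp.length_lt

theorem exists_memory {n w : ℕ} (hn : 0 < n) (hw : 1000 * (n + 1) ^ 4 ≤ 2 ^ w)
    (G : SimpleGraph (Fin n)) (S : Finset (Fin n × Fin n)) (pivot : Fin n → Fin n) :
    ∃ mem : List (BitVec w), mem.length = 16 * (6 * S.card + 1 + n) ∧
      ∀ u v : Fin n, ∃ out : BitVec w,
        Answers QueryExpr.query.program mem QueryExpr.query.program.length
          (BitVec.ofNat w u) (BitVec.ofNat w v) out ∧
        decode out = storedEstimate G S pivot u v := by
  -- Bertrand's postulate: p exceeds every key u n + v, yet p² ≤ 4n⁴ fits into a word, so the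
  -- products in the hash function do not overflow.
  obtain ⟨p, hp, hnp, hpn⟩ := Nat.exists_prime_lt_and_le_two_mul (n ^ 2) (by positivity)
  choose d hd using exists_encodesDist_edist G
  have hd2 : ∀ u v, d u v ≤ 2 * n := fun u v => by rcases hd u v with h | h <;> omega
  set code : Fin n × Fin n → ℕ := fun z => z.1 * n + z.2 with hcode
  have hdiv : ∀ z, code z / n = z.1 := fun z => by
    simp only [hcode]
    rw [Nat.add_div_of_dvd_right (dvd_mul_left _ _), Nat.mul_div_cancel _ hn,
      Nat.div_eq_of_lt z.2.2, add_zero]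
  have hmod : ∀ z, code z % n = z.2 := fun z => by
    simp only [hcode]
    rw [Nat.mul_add_mod_self_right, Nat.mod_eq_of_lt z.2.2]
  have hinj : Function.Injective code := fun z z' h => by
    ext
    · rw [← hdiv, ← hdiv, h]
    · rw [← hmod, ← hmod, h]
  have hlt : ∀ z, code z < n ^ 2 := fun z => by
    have h1 : (z.1 + 1) * n ≤ n * n := Nat.mul_le_mul_right _ z.1.2
    have h2 := z.2.2
    simp only [hcode]
    nlinarith
  have : NeZero n := ⟨hn.ne'⟩
  set D : ℕ → ℕ := fun k => d (Fin.ofNat n (k / n)) (Fin.ofNat n (k % n)) with hDdef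
  have hDcode : ∀ z, D (code z) = d z.1 z.2 := fun z => by simp [hDdef, hdiv, hmod]
  have hSp : ∀ x ∈ S.image code, x < p := by
    intro x hx
    obtain ⟨z, -, rfl⟩ := Finset.mem_image.mp hx
    exact (hlt z).trans hnp
  obtain ⟨H, rfl, hB, hH⟩ := exists_hashTable hp hSp
  obtain ⟨key, val, hkv, hkey, hval⟩ := exists_key_val hH hSp (q := 2 * n) (D := D)
    (fun k _ => hd2 _ _)
  rw [Finset.card_image_of_injective _ hinj] at hB
  have hcard : S.card ≤ n ^ 2 := by
    refine (Finset.card_le_univ _).trans ?_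
    simp [sq]
  set M : Content := ⟨n, H, key, val, fun i => pivot (Fin.ofNat n i)⟩ with hM
  set L := 6 * S.card + 1 + n with hL
  have hbig : 16 * L < 2 ^ w ∧ H.p ^ 2 < 2 ^ w := by
    have h1 : H.p ^ 2 ≤ (2 * n ^ 2) ^ 2 := Nat.pow_le_pow_left hpn 2
    have h2 : n ^ 2 ≤ n ^ 4 := Nat.pow_le_pow_right hn (by norm_num)
    have h3 : n ≤ n ^ 4 := Nat.le_self_pow (by norm_num) n
    have h4 : n ^ 4 + 1 ≤ (n + 1) ^ 4 := by nlinarith [pow_pos hn 3, pow_pos hn 2]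
    constructor
    · omega
    · nlinarith
  have hfits : M.Fits w L := by
    refine ⟨hn, by simp only [hM, hL]; omega, ?_, hbig.1, hbig.2, hnp.le, hp.one_lt, hkey, hval,
      fun i => (pivot _).2⟩
    exact ⟨hB.r_pos, hB.a_lt, hB.mult_lt, hB.r_le.trans (by omega),
      fun i hi => (hB.off_le i hi).trans (by omega), hB.size_pos,
      fun i hi => (hB.size_le i hi).trans (by omega), fun x => (hB.slot_lt x).trans_le (by omega)⟩
  have hlook : ∀ u v : Fin n, EncodesDist n (storedDist G S u v) (M.lookup (u * n + v)) := by
    intro u v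
    have h1 : M.lookup (u * n + v) = if code (u, v) ∈ S.image code then D (code (u, v))
      else 2 * n := hkv _
    rw [h1, hDcode]
    simp only [Finset.mem_image, hinj.eq_iff, exists_eq_right, storedDist]
    split_ifs
    · exact hd u v
    · exact Or.inr ⟨rfl, rfl⟩
  refine ⟨M.memory w L, M.length_memory w L, fun u v =>
    ⟨_, QueryExpr.answers_program _ _ _ _, ?_⟩⟩
  have hto : ∀ u : Fin n, (BitVec.ofNat w u).toNat = u := fun u => by
    have := u.2
    have := hfits.four_mul_lt
    rw [BitVec.toNat_ofNat, Nat.mod_eq_of_lt]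
    change 4 * n < _ at this
    omega
  have hpiv : ∀ u : Fin n, M.pivot u = pivot u := fun u => by simp [hM]
  have henc := (hlook u v).encodes.min (((hlook (pivot u) u).add (hlook (pivot u) v)).min
    ((hlook (pivot v) u).add (hlook (pivot v) v)))
  change Encodes _ (storedEstimate G S pivot u v) _ at henc
  generalize he : min (M.lookup (u * n + v)) _ = e at henc
  have hq := hfits.computes_query u.2 v.2 (hto u) (hto v) (e := e)
    (by rw [hpiv, hpiv]; exact he.symm)
  change BitVec.toNat _ = if e < 2 * n then e else 2 ^ w - 1 at hq
  have h4 : 4 * n < 2 ^ w := hfits.four_mul_lt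
  unfold decode
  rw [hq]
  rcases henc with ⟨h, hm⟩ | ⟨h, hm⟩
  -- Finite estimates are below 2n < 2^w - 1, so they are not mistaken for the word of ∞.
  · rw [if_pos hm, if_neg (by omega), h]
  · rw [if_neg (not_lt.mpr hm : ¬ e < 2 * n), if_pos rfl, h]

end ADO

/-! ### Balls of radius rad(s) and linked pairs -/

namespace ADO

section Graph

variable {n : ℕ} (G : SimpleGraph (Fin n))

theorem exists_edist_eq_of_edist_eq_add {u v : Fin n} {i j : ℕ}
    (h : G.edist u v = ((i + j : ℕ) : ℕ∞)) :
    ∃ w, G.edist u w = i ∧ G.edist w v = j := by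
  obtain ⟨p, hp⟩ := G.exists_walk_of_edist_eq_coe h
  have h1 : G.edist u (p.getVert i) ≤ i := by
    refine (G.edist_le (p.take i)).trans ?_
    rw [SimpleGraph.Walk.take_length]
    exact_mod_cast min_le_left _ _
  have h2 : G.edist (p.getVert i) v ≤ j := by
    refine (G.edist_le (p.drop i)).trans ?_
    rw [SimpleGraph.Walk.drop_length, hp]
    exact_mod_cast (by omega)
  have h3 := G.edist_triangle (u := u) (v := p.getVert i) (w := v)
  refine ⟨p.getVert i, ?_⟩
  obtain ⟨a, ha⟩ := ENat.ne_top_iff_exists.mp (ne_top_of_le_ne_top (ENat.natCast_ne_top _) h1)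
  obtain ⟨b, hb⟩ := ENat.ne_top_iff_exists.mp (ne_top_of_le_ne_top (ENat.natCast_ne_top _) h2)
  rw [h, ← ha, ← hb] at h3
  rw [← ha] at h1 ⊢
  rw [← hb] at h2 ⊢
  norm_cast at *
  omega

theorem mem_N_of_edist_le_rad {u v : Fin n} {s : ℝ} (h0 : 0 < G.edist u v)
    (h1 : G.edist u v ≠ ⊤) (h : G.edist u v ≤ rad G s) : u ∈ N G v s := by
  obtain ⟨m, hm⟩ := ENat.ne_top_iff_exists.mp h1
  -- The supremum need not be attained, but some admissible radius exceeds m - 1 and is thus at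
  -- least m.
  have hlt : ((m - 1 : ℕ) : ℕ∞) < truncEcc G v s := by
    refine lt_of_lt_of_le ?_ (h.trans (iInf_le _ v))
    rw [← hm] at h0 ⊢
    norm_cast at *
    omega
  obtain ⟨_, ⟨j, rfl, -, hj⟩, hlt⟩ := lt_sSup_iff.mp hlt
  refine hj ⟨h0, ?_⟩
  rw [← hm]
  norm_cast at *
  omega

theorem bfsRank_lt_or_lt {v u u' : Fin n} (hu : u ≠ v) (hu' : u' ≠ v) (h : u ≠ u') :
    bfsRank G v u < bfsRank G v u' ∨ bfsRank G v u' < bfsRank G v u := by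
  have key : ∀ a b : Fin n, a ≠ v →
      (G.edist a v < G.edist b v ∨ (G.edist a v = G.edist b v ∧ a < b)) →
      bfsRank G v a < bfsRank G v b := by
    intro a b ha hab
    refine Set.ncard_lt_ncard (Set.ssubset_iff_of_subset ?_ |>.mpr ⟨a, ⟨ha, hab⟩, ?_⟩)
      (Set.toFinite _)
    · rintro w ⟨hw, h⟩
      refine ⟨hw, ?_⟩
      rcases h with h | ⟨h, h'⟩ <;> rcases hab with h2 | ⟨h2, h2'⟩
      · exact Or.inl (h.trans h2)
      · exact Or.inl (h.trans_eq h2)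
      · exact Or.inl (h.trans_lt h2)
      · exact Or.inr ⟨h.trans h2, h'.trans h2'⟩
    · rintro ⟨-, h | ⟨-, h⟩⟩ <;> exact lt_irrefl _ h
  rcases lt_trichotomy (G.edist u v) (G.edist u' v) with h1 | h1 | h1
  · exact Or.inl (key _ _ hu (Or.inl h1))
  · rcases lt_or_gt_of_ne h with h2 | h2
    · exact Or.inl (key _ _ hu (Or.inr ⟨h1, h2⟩))
    · exact Or.inr (key _ _ hu' (Or.inr ⟨h1.symm, h2⟩))
  · exact Or.inr (key _ _ hu' (Or.inl h1))

theorem ncard_N_le (v : Fin n) (s : ℝ) : (N G v s).ncard ≤ ⌊s⌋₊ := by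
  calc _ ≤ (Finset.range ⌊s⌋₊ : Set ℕ).ncard := by
        refine Set.ncard_le_ncard_of_injOn (bfsRank G v) (fun u hu => ?_) ?_ (Set.toFinite _)
        · simpa using hu.2.2
        · intro u hu u' hu' h
          by_contra hne
          rcases bfsRank_lt_or_lt G hu.1 hu'.1 hne with h1 | h1 <;> omega
    _ = _ := by rw [Set.ncard_coe_finset, Finset.card_range]

open Classical in
/-- The vertices of the ball with centre `w` and radius `rad(s)`. -/
noncomputable def near (s : ℝ) (w : Fin n) : Finset (Fin n) :=
  {w' | G.edist w' w ≠ ⊤ ∧ G.edist w' w ≤ rad G s}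

theorem mem_near {s : ℝ} {w w' : Fin n} :
    w' ∈ near G s w ↔ G.edist w' w ≠ ⊤ ∧ G.edist w' w ≤ rad G s := by simp [near]

theorem mem_near_comm {s : ℝ} {w w' : Fin n} : w' ∈ near G s w ↔ w ∈ near G s w' := by
  rw [mem_near, mem_near, G.edist_comm]

theorem card_near_le (s : ℝ) (w : Fin n) : (near G s w).card ≤ ⌊s⌋₊ + 1 := by
  rw [← Set.ncard_coe_finset]
  calc _ ≤ (insert w (N G w s)).ncard := by
        refine Set.ncard_le_ncard (fun u hu => ?_) (Set.toFinite _)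
        obtain ⟨h1, h2⟩ := (mem_near G).mp hu
        by_cases huw : u = w
        · exact Or.inl huw
        · exact Or.inr (mem_N_of_edist_le_rad G (G.edist_pos_of_ne huw) h1 h2)
    _ ≤ _ := (Set.ncard_insert_le _ _).trans (Nat.add_le_add_right (ncard_N_le G w s) 1)

/-- The pairs of points that lie in the clusters of two points at distance at most `rad(s)`. -/
noncomputable def linkedPairs (s : ℝ) (A : Finset (Fin n)) : Finset (Fin n × Fin n) :=
  Finset.univ.biUnion fun w => (near G s w).biUnion fun w' =>
    cluster G.edist A w ×ˢ cluster G.edist A w'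

/-- AM-GM replaces each product of cluster sizes by the mean of their squares. Nearness is
symmetric, so both halves give the same sum, and each w has at most ⌊s⌋ + 1 near vertices. -/
theorem card_linkedPairs_le (s : ℝ) (A : Finset (Fin n)) :
    (linkedPairs G s A).card ≤ (⌊s⌋₊ + 1) * ∑ w, (cluster G.edist A w).card ^ 2 := by
  set c : Fin n → ℕ := fun w => (cluster G.edist A w).card
  have h1 : (linkedPairs G s A).card ≤ ∑ w, ∑ w' ∈ near G s w, c w * c w' := by
    refine Finset.card_biUnion_le.trans (Finset.sum_le_sum fun w _ => ?_)
    refine Finset.card_biUnion_le.trans (Finset.sum_le_sum fun w' _ => ?_)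
    rw [Finset.card_product]
  have h2 : ∑ w, ∑ _w' ∈ near G s w, c w ^ 2 ≤ (⌊s⌋₊ + 1) * ∑ w, c w ^ 2 := by
    rw [Finset.mul_sum]
    refine Finset.sum_le_sum fun w _ => ?_
    rw [Finset.sum_const, smul_eq_mul]
    exact Nat.mul_le_mul_right _ (card_near_le G s w)
  have h3 : ∑ w, ∑ w' ∈ near G s w, c w' ^ 2 = ∑ w, ∑ _w' ∈ near G s w, c w ^ 2 :=
    Finset.sum_comm' fun w w' => by simp [mem_near_comm G (w := w)]
  have h4 : 2 * ∑ w, ∑ w' ∈ near G s w, c w * c w' ≤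
      ∑ w, ∑ w' ∈ near G s w, (c w ^ 2 + c w' ^ 2) := by
    simp_rw [Finset.mul_sum]
    gcongr with w _ w' _
    nlinarith [two_mul_le_add_sq (c w) (c w')]
  simp_rw [Finset.sum_add_distrib] at h4
  change _ ≤ (⌊s⌋₊ + 1) * ∑ w, c w ^ 2
  omega

/-! ### The stretch -/

theorem edist_le_storedDist (S : Finset (Fin n × Fin n)) (u v : Fin n) :
    G.edist u v ≤ storedDist G S u v := by
  unfold storedDist
  split_ifs
  exacts [le_rfl, le_top]

theorem edist_le_storedEstimate (S : Finset (Fin n × Fin n)) (pivot : Fin n → Fin n)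
    (u v : Fin n) : G.edist u v ≤ storedEstimate G S pivot u v := by
  have key : ∀ a, G.edist u v ≤ storedDist G S a u + storedDist G S a v := fun a =>
    (G.edist_triangle (v := a)).trans (add_le_add
      ((G.edist_comm (u := u)).le.trans (edist_le_storedDist G S a u))
      (edist_le_storedDist G S a v))
  exact le_min (edist_le_storedDist G S u v) (le_min (key _) (key _))

/-- Greedy splitting: i takes up to a - 1, j up to b - 1 of the rest, and k the remainder, at most r
because d ≤ (a - 1) + (b - 1) + r. An infinite bound can absorb all of d. -/
theorem exists_add_eq_of_lt {a b r : ℕ∞} {d : ℕ} (ha : a ≠ 0) (hb : b ≠ 0)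
    (h : (d : ℕ∞) + 1 < a + b + r) :
    ∃ i j k : ℕ, d = i + (k + j) ∧ (i : ℕ∞) < a ∧ (j : ℕ∞) < b ∧ (k : ℕ∞) ≤ r := by
  have ha' := pos_iff_ne_zero.mpr ha
  have hb' := pos_iff_ne_zero.mpr hb
  induction a with
  | top => exact ⟨d, 0, 0, by omega, ENat.natCast_lt_top _, by simpa using hb', by simp⟩
  | coe a =>
    induction b with
    | top => exact ⟨0, d, 0, by omega, by simpa using ha', ENat.natCast_lt_top _, by simp⟩
    | coe b =>
      induction r with
      | top => exact ⟨0, 0, d, by omega, by simpa using ha', by simpa using hb', le_top⟩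
      | coe r =>
        norm_cast at *
        refine ⟨min d (a - 1), min (d - min d (a - 1)) (b - 1),
          d - min d (a - 1) - min (d - min d (a - 1)) (b - 1), ?_⟩
        omega

variable {G} {s : ℝ} {A : Finset (Fin n)}

/-- On a shortest path, the vertices at distance i from u and j from v are at distance k from each
other, and their clusters contain u and v. -/
theorem mem_linkedPairs_of_edist_eq {u v : Fin n} {i j k : ℕ}
    (h : G.edist u v = ((i + (k + j) : ℕ) : ℕ∞)) (hk : (k : ℕ∞) ≤ rad G s)
    (hi : ∀ a ∈ A, (i : ℕ∞) < G.edist u a) (hj : ∀ a ∈ A, (j : ℕ∞) < G.edist v a) :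
    (u, v) ∈ linkedPairs G s A := by
  obtain ⟨w, huw, hwv⟩ := exists_edist_eq_of_edist_eq_add G h
  obtain ⟨w', hww', hwv'⟩ := exists_edist_eq_of_edist_eq_add G hwv
  simp only [linkedPairs, Finset.mem_biUnion, Finset.mem_univ, true_and, Finset.mem_product,
    mem_cluster, mem_near]
  refine ⟨w, w', ?_, fun a ha => ?_, fun a ha => ?_⟩
  · rw [G.edist_comm, hww']
    exact ⟨ENat.natCast_ne_top _, hk⟩
  · rw [huw]; exact hi a ha
  · rw [G.edist_comm, hwv']; exact hj a ha

theorem edist_add_edist_add_rad_le {pivot : Fin n → Fin n}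
    (hpivot : ∀ u, ∀ a ∈ A, G.edist u (pivot u) ≤ G.edist u a) {u v : Fin n} {d : ℕ}
    (hd : G.edist u v = d) (huv : (u, v) ∉ linkedPairs G s A)
    (hu : G.edist u (pivot u) ≠ 0) (hv : G.edist v (pivot v) ≠ 0) :
    G.edist u (pivot u) + G.edist v (pivot v) + rad G s ≤ d + 1 := by
  by_contra! h
  obtain ⟨i, j, k, rfl, hi, hj, hk⟩ := exists_add_eq_of_lt hu hv h
  exact huv (mem_linkedPairs_of_edist_eq hd hk (fun a ha => hi.trans_le (hpivot u a ha))
    fun a ha => hj.trans_le (hpivot v a ha))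

theorem toEReal_coe (k : ℕ) : toEReal (k : ℕ∞) = ((k : ℝ) : EReal) := by
  rw [EReal.coe_coe_eq_natCast]
  simp only [toEReal, ENat.toENNReal_coe]
  rw [← ENNReal.ofReal_natCast, EReal.coe_ennreal_ofReal, max_eq_left (Nat.cast_nonneg k)]
  rfl

theorem toEReal_le_toEReal {a b : ℕ∞} (h : a ≤ b) : toEReal a ≤ toEReal b := by
  unfold toEReal
  exact_mod_cast h

theorem toEReal_le_two_mul_add {e d r : ℕ} (h : e + r ≤ 2 * d + 1) :
    toEReal e ≤ 2 * toEReal d + (1 - toEReal r) := by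
  simp only [toEReal_coe]
  have h' : (e : ℝ) ≤ 2 * d + (1 - r) := by
    have : (e : ℝ) + r ≤ 2 * d + 1 := by exact_mod_cast h
    linarith
  rw [show (2 : EReal) = ((2 : ℝ) : EReal) from rfl, ← EReal.coe_one, ← EReal.coe_sub,
    ← EReal.coe_mul, ← EReal.coe_add, EReal.coe_le_coe_iff]
  exact h'

theorem isEstimate_storedEstimate {pivot : Fin n → Fin n}
    (hpivot : A.Nonempty → ∀ u, pivot u ∈ A ∧ ∀ a ∈ A, G.edist u (pivot u) ≤ G.edist u a)
    (u v : Fin n) :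
    IsEstimate 2 (1 - toEReal (rad G s)) (G.edist u v)
      (storedEstimate G (linkedPairs G s A ∪ A ×ˢ Finset.univ) pivot u v) := by
  set S := linkedPairs G s A ∪ A ×ˢ Finset.univ with hS
  refine ⟨edist_le_storedEstimate G S pivot u v, ?_⟩
  by_cases htop : G.edist u v = ⊤
  · exact le_max_of_le_left (by rw [htop]; exact toEReal_le_toEReal le_top)
  obtain ⟨d, hd⟩ := ENat.ne_top_iff_exists.mp htop
  by_cases huv : (u, v) ∈ linkedPairs G s A
  · refine le_max_of_le_left (toEReal_le_toEReal ((min_le_left _ _).trans ?_))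
    rw [storedDist, if_pos (by rw [hS, Finset.mem_union]; exact Or.inl huv)]
  -- Without centres every cluster is the whole vertex set, so every pair at finite distance is
  -- linked (take w' = w = v).
  have hA : A.Nonempty := by
    rw [Finset.nonempty_iff_ne_empty]
    rintro rfl
    exact huv (mem_linkedPairs_of_edist_eq (i := d) (j := 0) (k := 0) (by simpa using hd.symm)
      (by simp) (by simp) (by simp))
  have hp := hpivot hA
  have hdet : ∀ a ∈ A, ∀ z, storedDist G S a z = G.edist a z := fun a ha z =>
    if_pos (by rw [hS, Finset.mem_union, Finset.mem_product]; exact Or.inr ⟨ha, Finset.mem_univ _⟩)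
  have hu : storedEstimate G S pivot u v ≤
      G.edist u (pivot u) + G.edist u (pivot u) + G.edist u v := by
    refine (min_le_right _ _).trans ((min_le_left _ _).trans ?_)
    rw [hdet _ (hp u).1, hdet _ (hp u).1, G.edist_comm (u := pivot u) (v := u), add_assoc]
    refine add_le_add_right ?_ _
    rw [G.edist_comm (u := u) (v := pivot u)]
    exact G.edist_triangle
  have hv : storedEstimate G S pivot u v ≤
      G.edist v (pivot v) + G.edist v (pivot v) + G.edist u v := by
    refine (min_le_right _ _).trans ((min_le_right _ _).trans ?_)
    rw [hdet _ (hp v).1, hdet _ (hp v).1, G.edist_comm (u := pivot v) (v := v), add_comm,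
      add_assoc]
    refine add_le_add_right ?_ _
    rw [G.edist_comm (u := v) (v := pivot v), G.edist_comm (u := u)]
    exact G.edist_triangle
  by_cases hu0 : G.edist u (pivot u) = 0
  · exact le_max_of_le_left (toEReal_le_toEReal (by simpa [hu0] using hu))
  by_cases hv0 : G.edist v (pivot v) = 0
  · exact le_max_of_le_left (toEReal_le_toEReal (by simpa [hv0] using hv))
  have hle := edist_add_edist_add_rad_le (fun u => (hp u).2) hd.symm huv hu0 hv0
  -- The bound by d + 1 makes both pivot distances and the radius finite; an infinite radius is
  -- impossible in this case.
  have hne : ((d : ℕ∞) + 1) ≠ ⊤ := by exact_mod_cast ENat.natCast_ne_top (d + 1)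
  have hne' := ne_top_of_le_ne_top hne hle
  obtain ⟨h12, h3⟩ := WithTop.add_ne_top.mp hne'
  obtain ⟨h1, h2⟩ := WithTop.add_ne_top.mp h12
  obtain ⟨a, ha⟩ := ENat.ne_top_iff_exists.mp h1
  obtain ⟨b, hb⟩ := ENat.ne_top_iff_exists.mp h2
  obtain ⟨r, hr⟩ := ENat.ne_top_iff_exists.mp h3
  rw [← ha, ← hd] at hu
  rw [← hb, ← hd] at hv
  rw [← ha, ← hb, ← hr] at hle
  obtain ⟨e, he⟩ := ENat.ne_top_iff_exists.mp
    (ne_top_of_le_ne_top (b := ((a + a + d : ℕ) : ℕ∞)) (ENat.natCast_ne_top _) (by exact_mod_cast hu))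
  rw [← he] at hu hv ⊢
  rw [← hd, ← hr]
  norm_cast at hu hv hle
  exact le_max_of_le_right (toEReal_le_two_mul_add (by omega))

end Graph

end ADO

namespace ADO

/-! ### The size of the data structure -/

theorem exists_pivot {n : ℕ} (G : SimpleGraph (Fin n)) (A : Finset (Fin n)) :
    ∃ pivot : Fin n → Fin n,
      A.Nonempty → ∀ u, pivot u ∈ A ∧ ∀ a ∈ A, G.edist u (pivot u) ≤ G.edist u a := by
  by_cases hA : A.Nonempty
  · choose pivot h using fun u => A.exists_min_image (G.edist u) hA
    exact ⟨pivot, fun _ => h⟩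
  · exact ⟨id, fun h => absurd h hA⟩

theorem le_two_pow_wordSize (n : ℕ) : 1000 * (n + 1) ^ 4 ≤ 2 ^ wordSize 20 n := by
  set m := 2 ^ (Nat.log 2 n + 1) with hm
  have h1 : n + 1 ≤ m := Nat.lt_pow_succ_log_self (by norm_num) n
  -- This lets powers of m absorb the constant 1000 ≤ 2^10; the exponent 14 would already suffice.
  have h2 : 2 ≤ m := Nat.le_self_pow (by omega) 2
  calc 1000 * (n + 1) ^ 4 ≤ 2 ^ 10 * m ^ 4 := by gcongr; norm_num
    _ ≤ m ^ 10 * m ^ 4 := by gcongr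
    _ = m ^ 14 := by ring
    _ ≤ m ^ 20 := Nat.pow_le_pow_right (by omega) (by norm_num)
    _ = _ := by rw [hm, wordSize, ← pow_mul, mul_comm]

theorem wordSize_le {n : ℕ} (hn : 0 < n) : (wordSize 20 n : ℝ) ≤ 60 * Real.log (n + 2) := by
  have hn' : (1 : ℝ) ≤ n := by exact_mod_cast hn
  have h1 : (Nat.log 2 n : ℝ) * Real.log 2 ≤ Real.log (n + 2) := by
    rw [← Real.log_pow]
    refine Real.log_le_log (by positivity) ?_
    have : ((2 ^ Nat.log 2 n : ℕ) : ℝ) ≤ n := by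
      exact_mod_cast Nat.pow_log_le_self 2 hn.ne'
    push_cast at this
    linarith
  -- Here n + 2 ≥ 3 > e. With log 2 ≥ 1/2, the word size is at most 20(2 + 1) log(n + 2).
  have h2 : 1 ≤ Real.log (n + 2) := by
    rw [Real.le_log_iff_exp_le (by positivity)]
    linarith [Real.exp_one_lt_d9]
  have h3 := Real.log_two_gt_d9
  have h4 : (Nat.log 2 n : ℝ) * (1 / 2) ≤ Nat.log 2 n * Real.log 2 := by gcongr; linarith
  simp only [wordSize]
  push_cast
  linarith

theorem exists_card_linkedPairs_le {n : ℕ} (hn : 0 < n) (G : SimpleGraph (Fin n)) {α c : ℝ}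
    (hα : 0 ≤ α) (hc : 1 ≤ c) :
    ∃ A : Finset (Fin n),
      ((linkedPairs G (c * (n : ℝ) ^ (3 * α)) A ∪ A ×ˢ Finset.univ).card : ℝ) ≤
        34 * (c * (n : ℝ) ^ (5 / 3 + α)) := by
  have hn1 : (1 : ℝ) ≤ n := by exact_mod_cast hn
  have hn0 : (0 : ℝ) < n := by linarith
  set q : ℝ := (n : ℝ) ^ (2 / 3 + α) with hq
  set s : ℝ := c * (n : ℝ) ^ (3 * α) with hs
  have hq1 : 1 ≤ q := Real.one_le_rpow hn1 (by linarith)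
  have hs1 : 1 ≤ s := one_le_mul_of_one_le_of_one_le hc (Real.one_le_rpow hn1 (by linarith))
  obtain ⟨A, hA, h⟩ := exists_card_le_sum_card_cluster_sq_le G.edist ⌈q⌉₊
  rw [Fintype.card_fin] at h
  set M : ℝ := ∑ w, ((cluster G.edist A w).card : ℝ) ^ 2 with hM
  have hM0 : 0 ≤ M := Finset.sum_nonneg fun _ _ => sq_nonneg _
  clear_value M
  have hk : (A.card : ℝ) ≤ 2 * q := by
    have h1 := (Nat.ceil_lt_add_one (show 0 ≤ q by linarith)).le
    have h2 : (A.card : ℝ) ≤ ⌈q⌉₊ := by exact_mod_cast hA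
    linarith
  have hqM : q ^ 2 * M ≤ 16 * (n : ℝ) ^ 3 := by
    refine le_trans ?_ h
    gcongr
    exact Nat.le_ceil q
  have hqn : q * n = (n : ℝ) ^ (5 / 3 + α) := by
    rw [hq, ← Real.rpow_add_one hn0.ne']
    congr 1; ring
  -- The exponent of q is chosen for this balance: 3α + 3 = 2(2/3 + α) + (5/3 + α).
  have hpow : s * (n : ℝ) ^ 3 = q ^ 2 * (c * (n : ℝ) ^ (5 / 3 + α)) := by
    rw [hs, hq, mul_assoc, ← Real.rpow_natCast, ← Real.rpow_natCast, ← Real.rpow_add hn0,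
      ← Real.rpow_mul hn0.le, mul_left_comm, ← Real.rpow_add hn0]
    congr 2
    push_cast; ring
  have hlink : ((linkedPairs G s A).card : ℝ) ≤ 32 * (c * (n : ℝ) ^ (5 / 3 + α)) := by
    have h1 : ((linkedPairs G s A).card : ℝ) ≤ (⌊s⌋₊ + 1) * M := by
      rw [hM]
      exact_mod_cast card_linkedPairs_le G s A
    have h2 : (⌊s⌋₊ : ℝ) ≤ s := Nat.floor_le (by linarith)
    have h3 : ((linkedPairs G s A).card : ℝ) ≤ 2 * s * M := h1.trans (by gcongr; linarith)
    refine h3.trans (le_of_mul_le_mul_left (a := q ^ 2) ?_ (by positivity))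
    calc q ^ 2 * (2 * s * M) = 2 * s * (q ^ 2 * M) := by ring
      _ ≤ 2 * s * (16 * (n : ℝ) ^ 3) := by gcongr
      _ = 32 * (s * (n : ℝ) ^ 3) := by ring
      _ = _ := by rw [hpow]; ring
  refine ⟨A, ?_⟩
  have h1 : ((linkedPairs G s A ∪ A ×ˢ Finset.univ).card : ℝ) ≤
      (linkedPairs G s A).card + A.card * n := by
    have := Finset.card_union_le (linkedPairs G s A) (A ×ˢ Finset.univ)
    rw [Finset.card_product, Finset.card_univ, Fintype.card_fin] at this
    exact_mod_cast this
  have h2 : (A.card : ℝ) * n ≤ 2 * (c * (n : ℝ) ^ (5 / 3 + α)) := by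
    calc (A.card : ℝ) * n ≤ 2 * q * n := by gcongr
      _ = 2 * (1 * (n : ℝ) ^ (5 / 3 + α)) := by rw [mul_assoc, hqn, one_mul]
      _ ≤ _ := by gcongr
  linarith

end ADO

theorem mainTheorem2 :
    ∃ (P : List ADO.Instr) (t κ K : ℕ) (C : ℝ),
      ∀ (α c : ℝ), 0 ≤ α → α < 1 / 3 → 1 ≤ c →
        ∀ (n : ℕ) (G : SimpleGraph (Fin n)),
          ∃ mem : List (BitVec (ADO.wordSize κ n)),
            ((mem.length * ADO.wordSize κ n : ℕ) : ℝ) ≤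
                C * (c * (n : ℝ) ^ (5 / 3 + α)) * Real.log (n + 2) ^ K ∧
              ADO.IsOracle P mem t G 2
                (1 - ADO.toEReal (ADO.rad G (c * (n : ℝ) ^ (3 * α)))) := by
  -- With X = c n^(5/3+α) there are at most 34X stored pairs, hence at most 16(6·34 + 1 + 1)X =
  -- 3296X words of at most 60 log(n + 2) bits; 197760 = 3296·60.
  refine ⟨ADO.QueryExpr.query.program, ADO.QueryExpr.query.program.length, 20, 1, 197760,
    fun α c hα _ hc n G => ?_⟩
  rcases n.eq_zero_or_pos with rfl | hn
  · refine ⟨[], ?_, fun u => u.elim0⟩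
    have : 0 ≤ Real.log ((0 : ℕ) + 2) := Real.log_nonneg (by norm_num)
    rw [List.length_nil, zero_mul, Nat.cast_zero]
    positivity
  obtain ⟨A, hA⟩ := ADO.exists_card_linkedPairs_le hn G hα hc
  obtain ⟨pivot, hpivot⟩ := ADO.exists_pivot G A
  obtain ⟨mem, hlen, hmem⟩ := ADO.exists_memory hn (ADO.le_two_pow_wordSize n) G
    (ADO.linkedPairs G (c * (n : ℝ) ^ (3 * α)) A ∪ A ×ˢ Finset.univ) pivot
  refine ⟨mem, ?_, fun u v => ?_⟩
  · have hn1 : (1 : ℝ) ≤ n := by exact_mod_cast hn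
    have hX : (n : ℝ) ≤ c * (n : ℝ) ^ (5 / 3 + α) := by
      calc (n : ℝ) = 1 * (n : ℝ) ^ (1 : ℝ) := by rw [Real.rpow_one, one_mul]
        _ ≤ _ := by gcongr; linarith
    set X := c * (n : ℝ) ^ (5 / 3 + α)
    rw [Nat.cast_mul, hlen, pow_one]
    push_cast
    calc _ ≤ (3296 * X) * (60 * Real.log (n + 2)) :=
          mul_le_mul (by linarith) (ADO.wordSize_le hn) (Nat.cast_nonneg _) (by linarith)
      _ = _ := by ring
  · obtain ⟨out, hout, hdec⟩ := hmem u v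
    exact ⟨out, hout, hdec ▸ ADO.isEstimate_storedEstimate hpivot u v⟩
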